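/- Let $\mathbb{K}$ be a field and let $G$ be a finite subgroup of the additive group of $\mathbb{K}$. A \emph{loopless gain graph} $\Gamma$ with gain group $G$ consists of a finite vertex set $V_\Gamma$ and a set $E_\Gamma$ of edges $\{u,v\}_g$ with $u,v\in V_\Gamma$, $u\neq v$, $g\in G$, where $\{u,v\}_g=\{v,u\}_{-g}$. For $W\subseteq V_\Gamma$, the induced subgraph $\Gamma[W]$ has vertex set $W$ and edge set $E_{\Gamma[W]}=\{\{u,v\}_g\in E_\Gamma \mid u,v\in W\}$, and $\Gamma\setminus v:=\Gamma[V_\Gamma\setminus\{v\}]$. For $n\ge 0$, $K_n^G$ is the loopless gain graph on $\{1,\dots,n\}$ with all edges $\{i,j\}_g$, $i\ne j$, $g\in G$ ($K_0^G$ is the null graph, which has no vertices). An isomorphism of gain graphs is a bijection of the vertices preserving edges and non-edges together with their gains. A vertex $v$ is \emph{link simplicial} if, whenever $\{u,v\}_g,\{v,w\}_h\in E_\Gamma$ with $u\neq w$, also $\{u,w\}_{g+h}\in E_\Gamma$. Let $\mathcal{C}^G_+$ be the smallest class of loopless gain graphs with gain group $G$ such that: (i) the null graph belongs to $\mathcal{C}^G_+$;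 (ii) if $\Gamma$ has a link-simplicial vertex $v$ with $\Gamma\setminus v\in\mathcal{C}^G_+$, then $\Gamma\in\mathcal{C}^G_+$; (iii) if $V_\Gamma=V_1\cup V_2$ with $\Gamma[V_1],\Gamma[V_2]\in\mathcal{C}^G_+$, $E_\Gamma=E_{\Gamma[V_1]}\cup E_{\Gamma[V_2]}$, and $\Gamma[V_1\cap V_2]\simeq K_n^G$ for some $n\geq 0$, then $\Gamma\in\mathcal{C}^G_+$. For a loopless gain graph $\Gamma$ with gain group $G$ on the vertex set $\{1,\dots,n\}$, let $\mathcal{A}_+(\Gamma)$ be the arrangement of linear hyperplanes in $\mathbb{K}^{n+1}$, with coordinates $z,x_1,\dots,x_n$, given by $$\mathcal{A}_+(\Gamma)=\{\{z=0\}\}\cup\{\{x_i-x_j=gz\}\mid \{i,j\}_g\in E_\Gamma\}.$$ For a hyperplane arrangement $\mathcal{A}$ (a finite set of linear subspaces of codimension one), let $M(\mathcal{A})$ be the matroid on $\mathcal{A}$ in which $\{H_1,\dots,H_m\}$ (distinct hyperplanes) is independent if and only if $\operatorname{codim}(H_1\cap\dots\cap H_m)=m$. The characteristic polynomial of a matroid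 $M$ on a finite set with rank function $r$ is $\chi(M,t)=\sum_F \mu(\hat 0,F)\,t^{r(M)-r(F)}\in\mathbb{Z}[t]$, the sum being over the flats $F$ of $M$, with $\mu$ the M\"obius function of the lattice of flats and $\hat 0$ the least flat. The arrangement $\mathcal{A}$ is \emph{divisionally free} if $M=M(\mathcal{A})$, of rank $m$ say, has a divisional flag, that is, a chain of flats $\varnothing=X_0\subseteq X_1\subseteq\dots\subseteq X_m=\mathcal{A}$ with $r(X_i)=i$ for $0\le i\le m$ and such that $\chi(M/X_{i+1},t)$ divides $\chi(M/X_i,t)$ in $\mathbb{Z}[t]$ for $0\le i\le m-1$. Then for every $\Gamma\in\mathcal{C}^G_+$ the arrangement $\mathcal{A}_+(\Gamma)$ is divisionally free. -/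

import Mathlib

open Polynomial

universe u v w

/-! ### Finite matroids: characteristic polynomials and divisional flags -/

/-- The poset `L(M)` of flats of a matroid, ordered by inclusion. -/
abbrev FlatLattice {α : Type u} (M : Matroid α) : Type u := {F : Set α // M.IsFlat F}

theorem FlatLattice.finite {α : Type u} (M : Matroid α) [M.Finite] : Finite (FlatLattice M) :=
  Set.Finite.to_subtype
    (s := {F : Set α | M.IsFlat F}) (M.ground_finite.finite_subsets.subset fun _ h => h.subset_ground)

/-- The least flat `0̂`: the closure of the empty set (which is `∅` when there are no loops). -/
def FlatLattice.bot {α : Type u} (M : Matroid α) : FlatLattice M :=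
  ⟨M.closure ∅, M.isFlat_closure ∅⟩

open Classical in
/-- The characteristic polynomial `χ(M, t) = ∑_{F ∈ L(M)} μ(0̂, F) t ^ (r(M) - r(F))`
of a matroid on a finite ground set. -/
noncomputable def Matroid.charPoly {α : Type u} (M : Matroid α) [M.Finite] : ℤ[X] :=
  letI : Finite (FlatLattice M) := FlatLattice.finite M
  letI : Fintype (FlatLattice M) := Fintype.ofFinite _
  letI : LocallyFiniteOrder (FlatLattice M) := Fintype.toLocallyFiniteOrder
  ∑ F : FlatLattice M,
    C (IncidenceAlgebra.mu ℤ (FlatLattice.bot M) F) * X ^ (M.eRank.toNat - (M.eRk F.1).toNat)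

/-- A divisional flag `∅ = X₀ ⊆ X₁ ⊆ ⋯ ⊆ Xₙ = E` of flats of a (simple) matroid of rank `n`:
`r(Xᵢ) = i` and `χ(M/Xᵢ₊₁, t)` divides `χ(M/Xᵢ, t)` in `ℤ[t]`. -/
structure Matroid.IsDivisionalFlag {α : Type u} (M : Matroid α) [M.Finite] {n : ℕ}
    (X : Fin (n + 1) → Set α) : Prop where
  eRank_eq : M.eRank = n
  isFlat : ∀ i, M.IsFlat (X i)
  mono : Monotone X
  zero_eq : X 0 = ∅
  last_eq : X (Fin.last n) = M.E
  eRk_eq : ∀ i, M.eRk (X i) = (i : ℕ)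
  dvd : ∀ i : Fin n, (M.contract (X i.succ)).charPoly ∣ (M.contract (X i.castSucc)).charPoly

/-! ### Central hyperplane arrangements -/

/-- A central hyperplane arrangement: a finite set of linear subspaces of codimension one. -/
structure Arrangement (K : Type u) (W : Type v) [Field K] [AddCommGroup W] [Module K W] where
  carrier : Set (Submodule K W)
  finite : carrier.Finite
  codim_eq_one : ∀ H ∈ carrier, Module.finrank K (W ⧸ H) = 1

section Codim

variable {K : Type u} {W : Type v} [Field K] [AddCommGroup W] [Module K W] [FiniteDimensional K W]

theorem codim_anti {P Q : Submodule K W} (h : P ≤ Q) :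
    Module.finrank K (W ⧸ Q) ≤ Module.finrank K (W ⧸ P) := by
  have h1 := P.finrank_quotient_add_finrank
  have h2 := Q.finrank_quotient_add_finrank
  have h3 := Submodule.finrank_mono h
  omega

theorem codim_inf_le {P H : Submodule K W} (hH : Module.finrank K (W ⧸ H) = 1) :
    Module.finrank K (W ⧸ (H ⊓ P)) ≤ Module.finrank K (W ⧸ P) + 1 := by
  have h1 := P.finrank_quotient_add_finrank
  have h2 := H.finrank_quotient_add_finrank
  have h3 := (H ⊓ P).finrank_quotient_add_finrank
  have h4 := Submodule.finrank_sup_add_finrank_inf_eq H P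
  have h5 := Submodule.finrank_le (H ⊔ P)
  omega

theorem codim_inf_lt {P H : Submodule K W} (h : ¬ P ≤ H) :
    Module.finrank K (W ⧸ P) < Module.finrank K (W ⧸ (H ⊓ P)) := by
  have h1 := P.finrank_quotient_add_finrank
  have h3 := (H ⊓ P).finrank_quotient_add_finrank
  have h4 : Module.finrank K (H ⊓ P : Submodule K W) < Module.finrank K P :=
    Submodule.finrank_lt_finrank_of_lt (inf_lt_right.2 h)
  omega

theorem Arrangement.codim_union_le (A : Arrangement K W) (J : Set (Submodule K W))
    {D : Set (Submodule K W)} (hD : D.Finite) :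
    D ⊆ A.carrier →
      Module.finrank K (W ⧸ sInf (D ∪ J)) ≤ Module.finrank K (W ⧸ sInf J) + D.ncard := by
  induction D, hD using Set.Finite.induction_on with
  | empty => intro _; rw [Set.empty_union, Set.ncard_empty, add_zero]
  | @insert a s ha hs ih =>
    intro h
    have h1 := ih ((Set.subset_insert a s).trans h)
    rw [Set.insert_union, sInf_insert, Set.ncard_insert_of_notMem ha hs]
    have h2 := codim_inf_le (P := sInf (s ∪ J)) (A.codim_eq_one a (h (Set.mem_insert a s)))
    omega

theorem Arrangement.codim_le (A : Arrangement K W) {D : Set (Submodule K W)}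
    (hD : D ⊆ A.carrier) : Module.finrank K (W ⧸ sInf D) ≤ D.ncard := by
  have h := A.codim_union_le ∅ (A.finite.subset hD) hD
  have h0 : Module.finrank K (W ⧸ (⊤ : Submodule K W)) = 0 := by
    have := (⊤ : Submodule K W).finrank_quotient_add_finrank
    rw [finrank_top] at this
    omega
  rw [Set.union_empty, sInf_empty, h0, zero_add] at h
  exact h

/-- The linear dependence matroid `M(A)` on an arrangement: a subset `{H₁, …, Hₙ}` of `A` is
independent if and only if `H₁ ∩ ⋯ ∩ Hₙ` has codimension `n`. -/
def Arrangement.matroid (A : Arrangement K W) : Matroid (Submodule K W) :=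
  (IndepMatroid.ofFinite A.finite
    (fun I => I ⊆ A.carrier ∧ Module.finrank K (W ⧸ sInf I) = I.ncard)
    (by
      refine ⟨Set.empty_subset _, ?_⟩
      have := A.codim_le (Set.empty_subset _)
      simpa using this)
    (by
      rintro I J ⟨hJ, hJc⟩ hIJ
      refine ⟨hIJ.trans hJ, le_antisymm (A.codim_le (hIJ.trans hJ)) ?_⟩
      have hfin := A.finite.subset hJ
      have h := A.codim_union_le I (hfin.subset (Set.sdiff_subset (s := J) (t := I)))
        (Set.sdiff_subset.trans hJ)
      rw [Set.sdiff_union_of_subset hIJ, hJc] at h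
      have h2 := Set.ncard_sdiff_add_ncard_of_subset hIJ hfin
      omega)
    (by
      rintro I J ⟨hI, hIc⟩ ⟨hJ, hJc⟩ hlt
      have hex : ∃ e ∈ J, ¬ sInf I ≤ e := by
        by_contra! hcon
        have := codim_anti (le_sInf hcon)
        omega
      obtain ⟨e, heJ, he⟩ := hex
      have heI : e ∉ I := fun h => he (sInf_le h)
      refine ⟨e, heJ, heI, Set.insert_subset (hJ heJ) hI, ?_⟩
      rw [sInf_insert, Set.ncard_insert_of_notMem heI (A.finite.subset hI)]
      have h1 := codim_inf_le (P := sInf I) (A.codim_eq_one e (hJ heJ))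
      have h2 := codim_inf_lt he
      omega)
    (fun _ h => h.1)).matroid

theorem Arrangement.matroid_ground (A : Arrangement K W) : A.matroid.E = A.carrier := rfl

theorem Arrangement.matroid_indep_iff (A : Arrangement K W) (I : Set (Submodule K W)) :
    A.matroid.Indep I ↔ I ⊆ A.carrier ∧ Module.finrank K (W ⧸ sInf I) = I.ncard := by
  simp [Arrangement.matroid]

instance (A : Arrangement K W) : A.matroid.Finite := ⟨A.finite⟩

/-- An arrangement is divisionally free if its linear dependence matroid has a divisional flag. -/
def Arrangement.DivisionallyFree (A : Arrangement K W) : Prop :=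
  ∃ (n : ℕ) (X : Fin (n + 1) → Set (Submodule K W)), A.matroid.IsDivisionalFlag X

end Codim

/-! ### Loopless gain graphs -/

/-- A loopless gain graph with gain group `G` (written additively). The vertex set is finite, and
`Adj u v g` says that the class `{u, v}_g = {v, u}_{-g}` is an edge; thus the edge set is encoded
as a finite set of triples `(u, v, g)` with `u ≠ v` that is stable under
`(u, v, g) ↦ (v, u, -g)`. -/
structure LooplessGainGraph (G : Type v) [AddGroup G] where
  V : Type u
  finite_vertices : Finite V
  Adj : V → V → G → Prop
  symm : ∀ {u v g}, Adj u v g → Adj v u (-g)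
  ne_of_adj : ∀ {u v g}, Adj u v g → u ≠ v
  finite_edges : {e : V × V × G | Adj e.1 e.2.1 e.2.2}.Finite

namespace LooplessGainGraph

variable {G : Type v} [AddGroup G]

/-- The subgraph `Γ[W]` induced by a set `W` of vertices. -/
def induce (Γ : LooplessGainGraph.{u} G) (W : Set Γ.V) : LooplessGainGraph.{u} G where
  V := W
  finite_vertices := haveI := Γ.finite_vertices; inferInstance
  Adj u v g := Γ.Adj u v g
  symm h := Γ.symm h
  ne_of_adj h e := Γ.ne_of_adj h (congrArg Subtype.val e)
  finite_edges := Γ.finite_edges.preimage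
    (f := fun e : W × W × G => ((e.1 : Γ.V), (e.2.1 : Γ.V), e.2.2)) (by
      rintro ⟨a, b, g⟩ - ⟨a', b', g'⟩ - h
      simp only [Prod.mk.injEq] at h
      exact Prod.ext (Subtype.ext h.1) (Prod.ext (Subtype.ext h.2.1) h.2.2))

/-- The complete loopless gain graph `K_n^G` over a finite group `G`: all the edges `{i, j}_g`
with `i ≠ j` and `g ∈ G`. -/
def complete (G : Type v) [AddGroup G] [Finite G] (n : ℕ) : LooplessGainGraph.{0} G where
  V := Fin n
  finite_vertices := inferInstance
  Adj i j _ := i ≠ j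
  symm h := h.symm
  ne_of_adj h := h
  finite_edges := Set.toFinite _

/-- An isomorphism of gain graphs: a bijection between the vertices that preserves edges and
non-edges, together with their gains. -/
structure Iso (Γ : LooplessGainGraph.{u} G) (Δ : LooplessGainGraph.{w} G) where
  toEquiv : Γ.V ≃ Δ.V
  adj_iff : ∀ u v g, Δ.Adj (toEquiv u) (toEquiv v) g ↔ Γ.Adj u v g

/-- `v` is link simplicial: if `{u, v}_g` and `{v, w}_h` are edges, with `u` and `w` distinct,
then `{u, w}_{g + h}` is an edge. -/
def IsLinkSimplicial (Γ : LooplessGainGraph.{u} G) (v : Γ.V) : Prop :=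
  ∀ (u w : Γ.V) (g h : G), u ≠ w → Γ.Adj u v g → Γ.Adj v w h → Γ.Adj u w (g + h)

/-- The smallest class `C_+^G` of loopless gain graphs with gain group `G` that contains the null
graph and is closed under adding link-simplicial vertices and under gluing along induced
subgraphs isomorphic to some `K_n^G`. -/
inductive ExtendedLiftClass (G : Type v) [AddGroup G] [Finite G] :
    LooplessGainGraph.{u} G → Prop
  | null (Γ : LooplessGainGraph.{u} G) (h : IsEmpty Γ.V) : ExtendedLiftClass G Γ
  | linkSimplicial (Γ : LooplessGainGraph.{u} G) (v : Γ.V) (hv : Γ.IsLinkSimplicial v)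
      (h : ExtendedLiftClass G (Γ.induce {v}ᶜ)) : ExtendedLiftClass G Γ
  | glue (Γ : LooplessGainGraph.{u} G) (V₁ V₂ : Set Γ.V) (hV : V₁ ∪ V₂ = Set.univ)
      (h₁ : ExtendedLiftClass G (Γ.induce V₁)) (h₂ : ExtendedLiftClass G (Γ.induce V₂))
      (hE : ∀ u v g, Γ.Adj u v g → (u ∈ V₁ ∧ v ∈ V₁) ∨ (u ∈ V₂ ∧ v ∈ V₂))
      (n : ℕ) (hn : Nonempty (Iso (Γ.induce (V₁ ∩ V₂)) (complete G n))) :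
      ExtendedLiftClass G Γ

end LooplessGainGraph

/-! ### The arrangement of a loopless gain graph with additive gains -/

section ExtendedLiftArrangement

variable {K : Type v} [Field K]

theorem codim_ker_eq_one {W : Type u} [AddCommGroup W] [Module K W] (φ : W →ₗ[K] K)
    (hφ : φ ≠ 0) : Module.finrank K (W ⧸ LinearMap.ker φ) = 1 := by
  rw [(φ.quotKerEquivOfSurjective (LinearMap.surjective hφ)).finrank_eq, Module.finrank_self]

/-- The hyperplane `{z = 0}` of the space with coordinates `z = x none` and `x_i = x (some i)`. -/
def hyperplaneAtInfinity (K : Type v) [Field K] (V : Type u) : Submodule K (Option V → K) :=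
  LinearMap.ker (LinearMap.proj (R := K) (φ := fun _ : Option V => K) none)

/-- The hyperplane `{x_i - x_j = g z}`. -/
def edgeHyperplane {V : Type u} (i j : V) (g : K) : Submodule K (Option V → K) :=
  LinearMap.ker (LinearMap.proj (R := K) (φ := fun _ : Option V => K) (some i) -
    LinearMap.proj (some j) - g • LinearMap.proj none)

theorem mem_hyperplaneAtInfinity {V : Type u} (x : Option V → K) :
    x ∈ hyperplaneAtInfinity K V ↔ x none = 0 := Iff.rfl

theorem mem_edgeHyperplane {V : Type u} (i j : V) (g : K) (x : Option V → K) :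
    x ∈ edgeHyperplane i j g ↔ x (some i) - x (some j) = g * x none := by
  simp [edgeHyperplane, sub_eq_zero]

/-- The arrangement `A_+(Γ) = {{z = 0}} ∪ {{x_i - x_j = g z} | {i, j}_g ∈ E_Γ}` in `K ^ (n + 1)`
of a loopless gain graph with `n` vertices whose gain group is an additive subgroup of `K`. -/
def LooplessGainGraph.extendedLiftArrangement {G : AddSubgroup K}
    (Γ : LooplessGainGraph.{u} G) : Arrangement K (Option Γ.V → K) where
  carrier := {hyperplaneAtInfinity K Γ.V} ∪
    {H | ∃ (i j : Γ.V) (g : G), Γ.Adj i j g ∧ H = edgeHyperplane i j (g : K)}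
  finite := by
    refine (Set.finite_singleton _).union
      ((Γ.finite_edges.image fun e => edgeHyperplane e.1 e.2.1 (e.2.2 : K)).subset ?_)
    rintro H ⟨i, j, g, h, rfl⟩
    exact ⟨(i, j, g), h, rfl⟩
  codim_eq_one := by
    classical
    rintro H (rfl | ⟨i, j, g, h, rfl⟩)
    · refine codim_ker_eq_one _ fun h => ?_
      simpa using LinearMap.congr_fun h (Pi.single none 1)
    · refine codim_ker_eq_one _ fun h' => ?_
      have hij := Γ.ne_of_adj h
      simpa [Pi.single_apply, hij.symm] using LinearMap.congr_fun h' (Pi.single (some i) 1)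

instance {G : AddSubgroup K} (Γ : LooplessGainGraph.{u} G) : Finite Γ.V := Γ.finite_vertices

end ExtendedLiftArrangement

/-! The proof turns divisibility of characteristic polynomials into divisibility of numbers of
colourings. Let `n` be the number of vertices and `t = |G| k`. A colour `(g, i)` in `G × Fin k`
stands for `g + ξ_i`, where the `ξ_i` are generic transcendentals; a colouring of the vertices is a
point with `z = 1`, or a point at infinity. Taking `t - 1` copies of each finite point and one of
each point at infinity gives `t ^ (n + 1)` points, and every intersection of hyperplanes of
dimension `d` contains exactly `t ^ d` of them (`card_setOf_pointSubmodule_le`). This replaces the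
finite field method over an arbitrary field: by Möbius inversion, `χ(M/X, t)` is, up to a power of
`t`, the number of points whose flat is exactly `X`. When `X` comes from contracting edges, this is
`t - 1` times the number of proper colourings of the contracted gain graph, again up to a power of
`t` (`IsContraction.eval_charPoly`).

It remains to contract edges one at a time until none is left, so that the numbers of proper
colourings divide one another polynomially. For the induction, more is proved: a graph in the class
can be so reduced onto any complete subgraph `W` (`contractsOnto_of_extendedLiftClass`). Removing a
link-simplicial vertex `v` divides the count by a linear factor, and contracting an edge at `v` is,
up to relabelling and switching, removing `v`. For a gluing along a complete graph `C`, the counts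
satisfy `N(A₁ ∪ A₂) N(C) = N(A₁) N(A₂)`; one part is reduced onto `C`, where it is absorbed in the
other part, which is then reduced onto `W`.

For `W = ∅` the contractions give all flats of the flag but the last. The last step adds the
hyperplane at infinity and reaches the whole arrangement, where the characteristic polynomial is
`1`. -/

/-! ### Characteristic polynomials of contractions by counting -/

namespace Matroid

variable {α : Type u}

theorem eRk_contract_add_eRk (M : Matroid α) {X Y : Set α} (hX : X ⊆ M.E) (hY : Y ⊆ M.E)
    (hXY : Disjoint Y X) : (M.contract X).eRk Y + M.eRk X = M.eRk (Y ∪ X) := by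
  obtain ⟨I, hI⟩ := M.exists_isBasis X hX
  obtain ⟨J, hJ, hIJ⟩ := hI.indep.subset_isBasis_of_subset
    (hI.subset.trans (Set.subset_union_right (s := Y))) (Set.union_subset hY hX)
  have h1 := hI.contract_sdiff_isBasis_sdiff hJ hIJ
  rw [Set.union_sdiff_right, hXY.sdiff_eq_left] at h1
  have h2 : (M.contract X).IsBasis (J \ I) Y := by
    rw [hI.contract_eq_contract_delete, delete_isBasis_iff]
    exact ⟨h1, hXY.mono_right Set.sdiff_subset⟩
  rw [h2.eRk_eq_encard, hI.eRk_eq_encard, hJ.eRk_eq_encard,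
    Set.encard_sdiff_add_encard_of_subset hIJ]

theorem IsFlat.disjoint_of_contract {M : Matroid α} {X F : Set α}
    (hF : (M.contract X).IsFlat F) : Disjoint F X :=
  Set.disjoint_of_subset_left hF.subset_ground Set.disjoint_sdiff_left

theorem isFlat_contract_iff {M : Matroid α} {X F : Set α} (hX : X ⊆ M.E) (hFX : Disjoint F X) :
    (M.contract X).IsFlat F ↔ M.IsFlat (F ∪ X) := by
  rw [isFlat_iff_closure_eq, isFlat_iff_closure_eq, contract_closure_eq]
  constructor
  · intro h
    have h2 : X ⊆ M.closure (F ∪ X) :=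
      (M.subset_closure X hX).trans (M.closure_subset_closure Set.subset_union_right)
    rw [← Set.sdiff_union_of_subset h2, h]
  · intro h
    rw [h, Set.union_sdiff_right, hFX.sdiff_eq_left]

/-- The evaluation at `t` of the characteristic polynomial of a contraction `M / X`, computed by
counting in a family of flats in which every flat `F` is contained in `t ^ (D - r(F))` members. -/
theorem eval_charPoly_contract (M : Matroid α) [M.Finite] {X : Set α} (hX : M.IsFlat X)
    {Ω : Type w} [Finite Ω] (S : Ω → Set α) (hS : ∀ ω, M.IsFlat (S ω)) (t D : ℕ)
    (hD : M.eRank.toNat ≤ D)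
    (hcard : ∀ F, M.IsFlat F → Nat.card {ω // F ⊆ S ω} = t ^ (D - (M.eRk F).toNat)) :
    (M.contract X).charPoly.eval (t : ℤ) * (t : ℤ) ^ (D - M.eRank.toNat) =
      (Nat.card {ω // S ω = X} : ℤ) := by
  classical
  have := Fintype.ofFinite Ω
  let : Finite (FlatLattice (M.contract X)) := FlatLattice.finite _
  let : Fintype (FlatLattice (M.contract X)) := Fintype.ofFinite _
  let : LocallyFiniteOrder (FlatLattice (M.contract X)) := Fintype.toLocallyFiniteOrder
  have hchi : (M.contract X).charPoly = ∑ F : FlatLattice (M.contract X),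
      C (IncidenceAlgebra.mu ℤ (FlatLattice.bot (M.contract X)) F) *
        Polynomial.X ^ ((M.contract X).eRank.toNat - ((M.contract X).eRk F.1).toNat) := by
    unfold Matroid.charPoly
    rfl
  have hXE := hX.subset_ground
  have hfin : ∀ Y, M.eRk Y ≠ ⊤ := fun Y => M.eRk_ne_top_iff.2 (M.isRkFinite_set Y)
  have hrk : ∀ Y, Y ⊆ M.E → Disjoint Y X →
      ((M.contract X).eRk Y).toNat + (M.eRk X).toNat = (M.eRk (Y ∪ X)).toNat := by
    intro Y hY hYX
    rw [← M.eRk_contract_add_eRk hXE hY hYX, ENat.toNat_add _ (hfin X)]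
    exact (M.contract X).eRk_ne_top_iff.2 ((M.contract X).isRkFinite_set Y)
  have hrank : (M.contract X).eRank.toNat + (M.eRk X).toNat = M.eRank.toNat := by
    have := hrk (M.E \ X) Set.sdiff_subset Set.disjoint_sdiff_left
    rwa [Set.sdiff_union_of_subset hXE, eRk_ground, ← contract_ground, eRk_ground] at this
  have hbot : (FlatLattice.bot (M.contract X)).1 = ∅ := by
    simp [FlatLattice.bot, contract_closure_eq, hX.closure]
  -- The exponents add up to `D - r(F ∪ X)`, so each term of the polynomial counts the `ω` with `F ∪
  -- X ⊆ S ω`; the two sums can then be exchanged.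
  have hterm : ∀ F : FlatLattice (M.contract X),
      (t : ℤ) ^ ((M.contract X).eRank.toNat - ((M.contract X).eRk F.1).toNat) *
        (t : ℤ) ^ (D - M.eRank.toNat) = ∑ ω : Ω, if F.1 ∪ X ⊆ S ω then 1 else 0 := by
    intro F
    have hd := F.2.disjoint_of_contract
    have hFE : F.1 ⊆ M.E := F.2.subset_ground.trans Set.sdiff_subset
    have h1 := hcard _ ((isFlat_contract_iff hXE hd).1 F.2)
    have h2 := hrk F.1 hFE hd
    have h3 : (M.eRk (F.1 ∪ X)).toNat ≤ M.eRank.toNat :=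
      ENat.toNat_le_toNat (M.eRk_le_eRank _) (by rw [← eRk_ground]; exact hfin _)
    rw [Finset.sum_boole, ← pow_add, ← Fintype.card_subtype, ← Nat.card_eq_fintype_card, h1]
    push_cast
    congr 1
    omega
  rw [hchi, eval_finsetSum, Finset.sum_mul]
  simp only [eval_mul, eval_C, eval_pow, eval_X, mul_assoc, hterm, Finset.mul_sum]
  rw [Finset.sum_comm, Nat.card_eq_fintype_card, Fintype.card_subtype, ← Finset.sum_boole]
  refine Finset.sum_congr rfl fun ω _ => ?_
  -- For fixed `ω` the flats that contribute form the interval from the least flat of `M / X` to `S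
  -- ω \ X`. The Möbius function sums to zero over it unless `S ω = X`.
  by_cases hω : X ⊆ S ω
  · have hflat : (M.contract X).IsFlat (S ω \ X) := by
      rw [isFlat_contract_iff hXE Set.disjoint_sdiff_left, Set.sdiff_union_of_subset hω]
      exact hS ω
    have key := IncidenceAlgebra.sum_Icc_mu_right (𝕜 := ℤ) (FlatLattice.bot (M.contract X))
      ⟨S ω \ X, hflat⟩
    have heq : (FlatLattice.bot (M.contract X) = ⟨S ω \ X, hflat⟩) ↔ S ω = X := by
      rw [Subtype.ext_iff, hbot]
      constructor
      · intro h
        exact (Set.sdiff_eq_empty.1 h.symm).antisymm hω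
      · intro h
        simp [h]
    simp only [heq] at key
    rw [← key]
    simp only [mul_ite, mul_one, mul_zero]
    rw [← Finset.sum_filter]
    refine Finset.sum_congr ?_ fun _ _ => rfl
    ext F
    simp only [Finset.mem_filter, Finset.mem_univ, true_and, Finset.mem_Icc]
    have hb : FlatLattice.bot (M.contract X) ≤ F := by
      change (FlatLattice.bot (M.contract X)).1 ⊆ F.1
      rw [hbot]
      exact Set.empty_subset _
    rw [and_iff_right hb]
    change _ ↔ F.1 ⊆ S ω \ X
    rw [Set.union_subset_iff, and_iff_left hω, Set.subset_sdiff,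
      and_iff_left F.2.disjoint_of_contract]
  · rw [if_neg fun h => hω h.ge]
    refine Finset.sum_eq_zero fun F _ => ?_
    rw [if_neg fun h => hω (Set.subset_union_right.trans h), mul_zero]

end Matroid

/-! ### Gain graphs on a fixed vertex type: colourings, contractions, reductions -/

/-- Adjacency relations of gain graphs on a vertex type `V`: `A a b h` is the edge `{a, b}_h`. -/
abbrev GainRelation (V : Type u) (G : Type v) : Type (max u v) := V → V → G → Prop

namespace GainRelation

variable {V : Type u} {G : Type v} [AddCommGroup G]

/-- The free action of `G` on `G × Fin k` by translations of the first coordinate. -/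
def shift {k : ℕ} (h : G) (s : G × Fin k) : G × Fin k := (h + s.1, s.2)

theorem shift_shift {k : ℕ} (g h : G) (s : G × Fin k) : shift g (shift h s) = shift (g + h) s := by
  simp [shift, add_assoc]

@[simp] theorem shift_zero {k : ℕ} (s : G × Fin k) : shift 0 s = s := by
  simp [shift]

theorem shift_eq_iff {k : ℕ} {g : G} {s s' : G × Fin k} : s = shift g s' ↔ shift (-g) s = s' := by
  constructor
  · rintro rfl
    simp [shift_shift]
  · rintro rfl
    simp [shift_shift]

theorem shift_right_injective {k : ℕ} (g : G) :
    Function.Injective (shift g : G × Fin k → G × Fin k) := by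
  intro s s' h
  have := shift_eq_iff.1 h
  simpa [shift_shift] using this

theorem shift_left_inj {k : ℕ} {g h : G} {s : G × Fin k} : shift g s = shift h s ↔ g = h := by
  simp [shift]

/-- A colouring `x` is proper if no edge `{a, b}_h` has `x a = h + x b`. -/
def IsProper (A : GainRelation V G) {k : ℕ} (x : V → G × Fin k) : Prop :=
  ∀ a b h, A a b h → x a ≠ shift h (x b)

/-- The number of proper colourings. -/
noncomputable def numProper (A : GainRelation V G) (k : ℕ) : ℕ :=
  Nat.card {x : V → G × Fin k // A.IsProper x}

/-- The contraction that identifies every vertex `a` with `f a` by means of the gain `p a`. -/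
def contract (A : GainRelation V G) (f : V → V) (p : V → G) : GainRelation V G :=
  fun a b h => a ≠ b ∧ ∃ c d, f c = a ∧ f d = b ∧ A c d (h + p c - p d)

open Classical in
/-- The map that sends `v` to `u` and fixes the other vertices. -/
noncomputable def mergeMap (u v : V) : V → V := fun a => if a = v then u else a

open Classical in
/-- The contraction of the edge `{u, v}_g`, in which `v` becomes an isolated vertex. -/
noncomputable def elim (A : GainRelation V G) (u v : V) (g : G) : GainRelation V G :=
  A.contract (mergeMap u v) (Pi.single v (-g))

/-- The edges with both ends in `S`. -/
def restrict (A : GainRelation V G) (S : Set V) : GainRelation V G :=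
  fun a b h => a ∈ S ∧ b ∈ S ∧ A a b h

/-- All the edges with both ends in `W`. -/
def complete (W : Set V) : GainRelation V G := fun a b _ => a ∈ W ∧ b ∈ W ∧ a ≠ b

/-- The union of two gain graphs. -/
def union (A B : GainRelation V G) : GainRelation V G := fun a b h => A a b h ∨ B a b h

/-- Relabelling by a permutation of the vertices, followed by switching. -/
def relabel (A : GainRelation V G) (σ : Equiv.Perm V) (p : V → G) : GainRelation V G :=
  fun a b h => A (σ a) (σ b) (h + p a - p b)

/-- Up to the factor of an isolated vertex, the numbers of proper colourings of `B` divide those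
of `A`, with a quotient that is polynomial in the number of colours. -/
def CountDvd (A B : GainRelation V G) : Prop :=
  ∃ q : ℤ[X], ∀ k, Nat.card V ≤ k → ((Nat.card G * k : ℕ) : ℤ) * A.numProper k =
    q.eval ((Nat.card G * k : ℕ) : ℤ) * B.numProper k

/-- `A` can be reduced to the complete gain graph on `W` by contractions of edges that keep `W` and
divide the numbers of proper colourings. -/
inductive ContractsOnto (W : Set V) : GainRelation V G → Prop
  | of_complete (A : GainRelation V G) (h : A = complete W) : ContractsOnto W A
  | elim (A : GainRelation V G) (u v : V) (g : G) (hv : v ∉ W) (huv : u ≠ v) (hA : A u v g)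
      (hdvd : A.CountDvd (A.elim u v g)) (h : ContractsOnto W (A.elim u v g)) : ContractsOnto W A

/-! ### Invariance under relabelling and switching -/

section Relabel

theorem isProper_relabel_iff (A : GainRelation V G) (σ : Equiv.Perm V) (p : V → G) {k : ℕ}
    (x : V → G × Fin k) :
    (A.relabel σ p).IsProper x ↔ A.IsProper fun c => shift (p (σ.symm c)) (x (σ.symm c)) := by
  constructor
  · intro hx a b h hab heq
    refine hx (σ.symm a) (σ.symm b) (h + p (σ.symm b) - p (σ.symm a)) ?_ ?_
    · simpa [relabel] using hab
    · dsimp only at heq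
      rw [eq_comm, shift_eq_iff, shift_shift, shift_shift, eq_comm] at heq
      rw [heq]
      congr 1
      abel
  · intro hx a b h hab heq
    refine hx (σ a) (σ b) _ hab ?_
    simp only [Equiv.symm_apply_apply]
    rw [heq, shift_shift, shift_shift]
    congr 1
    abel

theorem numProper_relabel (A : GainRelation V G) (σ : Equiv.Perm V) (p : V → G) (k : ℕ) :
    (A.relabel σ p).numProper k = A.numProper k := by
  let e : (V → G × Fin k) ≃ (V → G × Fin k) :=
    { toFun x c := shift (p (σ.symm c)) (x (σ.symm c))
      invFun y a := shift (-p a) (y (σ a))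
      left_inv x := by
        funext a
        simp [shift_shift]
      right_inv y := by
        funext a
        simp [shift_shift] }
  exact Nat.card_congr (e.subtypeEquiv fun x => A.isProper_relabel_iff σ p x)

theorem relabel_contract (A : GainRelation V G) (σ : Equiv.Perm V) (p : V → G) (f : V → V)
    (s : V → G) : (A.contract f s).relabel σ p = (A.relabel σ p).contract (σ.symm ∘ f ∘ σ)
      (fun c => s (σ c) + p (σ.symm (f (σ c))) - p c) := by
  funext a b h
  apply propext
  constructor
  · rintro ⟨hab, c, d, hc, hd, hA⟩
    refine ⟨fun h => hab (h ▸ rfl), σ.symm c, σ.symm d, by simp [hc], by simp [hd], ?_⟩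
    simp only [relabel, Equiv.apply_symm_apply, hc, hd, Equiv.symm_apply_apply]
    convert hA using 1
    abel
  · rintro ⟨hab, c, d, hc, hd, hA⟩
    simp only [Function.comp_apply, Equiv.symm_apply_eq] at hc hd
    refine ⟨fun h => hab (σ.injective h), σ c, σ d, hc, hd, ?_⟩
    simp only [relabel, hc, hd, Equiv.symm_apply_apply] at hA
    convert hA using 1
    abel

theorem relabel_elim (A : GainRelation V G) (σ : Equiv.Perm V) (p : V → G) (u v : V) (g : G) :
    (A.elim u v g).relabel σ p = (A.relabel σ p).elim (σ.symm u) (σ.symm v)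
      (g - p (σ.symm u) + p (σ.symm v)) := by
  classical
  unfold elim
  rw [relabel_contract]
  congr 1
  · funext a
    by_cases ha : a = σ.symm v
    · simp [mergeMap, ha]
    · have : σ a ≠ v := fun h => ha (by simp [← h])
      simp [mergeMap, ha, this]
  · funext a
    by_cases ha : a = σ.symm v
    · subst ha
      simp [mergeMap]
      abel
    · have : σ a ≠ v := fun h => ha (by simp [← h])
      simp [mergeMap, ha, this]

theorem ContractsOnto.relabel {W : Set V} {A : GainRelation V G} (hA : ContractsOnto W A)
    (σ : Equiv.Perm V) (p : V → G) : ContractsOnto (σ ⁻¹' W) (A.relabel σ p) := by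
  induction hA with
  | of_complete A h =>
    refine .of_complete _ ?_
    subst h
    funext a b h
    simp [GainRelation.relabel, complete]
  | elim A u v g hv huv hA hdvd h ih =>
    refine .elim _ (σ.symm u) (σ.symm v) (g - p (σ.symm u) + p (σ.symm v)) (by simpa)
      (by simpa) ?_ ?_ ?_
    · simp only [GainRelation.relabel, Equiv.apply_symm_apply]
      convert hA using 1
      abel
    · rw [← relabel_elim]
      obtain ⟨q, hq⟩ := hdvd
      refine ⟨q, fun k hk => ?_⟩
      rw [numProper_relabel, numProper_relabel, hq k hk]
    · rwa [← relabel_elim]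

end Relabel

/-! ### Proper colourings of a union along a complete gain graph -/

section Union

/-- Permuting the `G`-orbits and translating within each of them gives permutations that commute
with `G`, and these act transitively on families of colours from distinct orbits. Such families are
the proper colourings of a complete gain graph, so all of them have equally many proper extensions.
-/
theorem exists_equiv_of_injective {C : Type w} {k : ℕ} (x y : C → G × Fin k)
    (hx : Function.Injective fun c => (x c).2) (hy : Function.Injective fun c => (y c).2) :
    ∃ α : (G × Fin k) ≃ (G × Fin k), (∀ h s, α (shift h s) = shift h (α s)) ∧
      ∀ c, α (y c) = x c := by
  classical
  let e := (Equiv.ofInjective _ hy).symm.trans (Equiv.ofInjective _ hx)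
  let π : Equiv.Perm (Fin k) := e.extendSubtype
  have hπ : ∀ c, π (y c).2 = (x c).2 := by
    intro c
    have h := e.extendSubtype_apply_of_mem (y c).2 ⟨c, rfl⟩
    refine h.trans ?_
    have : (⟨(y c).2, ⟨c, rfl⟩⟩ : Set.range fun c => (y c).2) = Equiv.ofInjective _ hy c := rfl
    rw [this]
    simp [e]
  let δ : Fin k → G := Function.extend (fun c => (y c).2) (fun c => (x c).1 - (y c).1) 0
  have hδ : ∀ c, δ (y c).2 = (x c).1 - (y c).1 := fun c => hy.extend_apply _ _ c
  refine ⟨⟨fun s => (s.1 + δ s.2, π s.2), fun s => (s.1 - δ (π.symm s.2), π.symm s.2),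
    fun s => by simp, fun s => by simp⟩, fun h s => ?_, fun c => ?_⟩
  · simp [shift, add_assoc]
  · simp [hπ, hδ]

theorem isProper_complete_iff {C : Set V} {k : ℕ} (x : V → G × Fin k) :
    (complete C : GainRelation V G).IsProper x ↔ Function.Injective fun c : C => (x c).2 := by
  constructor
  · intro hx a b hab
    by_contra hne
    refine hx a b ((x a).1 - (x b).1) ⟨a.2, b.2, fun h => hne (Subtype.ext h)⟩ ?_
    exact Prod.ext (by simp [shift]) hab
  · rintro hx a b h ⟨ha, hb, hab⟩ heq
    have h2 : (x a).2 = (shift h (x b)).2 := congrArg Prod.snd heq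
    exact hab (congrArg Subtype.val (@hx ⟨a, ha⟩ ⟨b, hb⟩ h2))

open Classical in
/-- Exchanging two colourings outside `S`, with a twist that depends on their restrictions
to `C ⊆ S`. -/
noncomputable def twistedSwap {T : Type w} {S C : Set V} (hCS : C ⊆ S)
    (α : (C → T) → (C → T) → (T ≃ T)) : ((V → T) × (V → T)) ≃ ((V → T) × (V → T)) where
  toFun q := (S.piecewise q.1 (α (q.1 ∘ (↑)) (q.2 ∘ (↑)) ∘ q.2), S.piecewise q.2 q.1)
  invFun q := (S.piecewise q.1 q.2, S.piecewise q.2 ((α (q.1 ∘ (↑)) (q.2 ∘ (↑))).symm ∘ q.1))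
  left_inv q := by
    have h1 : ∀ r r' : V → T, (S.piecewise r r') ∘ ((↑) : C → V) = r ∘ (↑) := fun r r' => by
      funext c
      simp [hCS c.2]
    refine Prod.ext ?_ ?_ <;> funext a <;> by_cases ha : a ∈ S <;> simp [ha, h1]
  right_inv q := by
    have h1 : ∀ r r' : V → T, (S.piecewise r r') ∘ ((↑) : C → V) = r ∘ (↑) := fun r r' => by
      funext c
      simp [hCS c.2]
    refine Prod.ext ?_ ?_ <;> funext a <;> by_cases ha : a ∈ S <;> simp [ha, h1]

theorem IsProper.mono {A B : GainRelation V G} {k : ℕ} {x : V → G × Fin k} (hB : B.IsProper x)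
    (h : ∀ a b h, A a b h → B a b h) : A.IsProper x :=
  fun a b g hab => hB a b g (h a b g hab)

theorem isProper_congr {A : GainRelation V G} {S : Set V}
    (hA : ∀ a b h, A a b h → a ∈ S ∧ b ∈ S) {k : ℕ} {x y : V → G × Fin k}
    (α : (G × Fin k) ≃ (G × Fin k)) (hα : ∀ h s, α (shift h s) = shift h (α s))
    (hxy : ∀ a ∈ S, x a = α (y a)) : A.IsProper x ↔ A.IsProper y := by
  refine forall₄_congr fun a b h hab => ?_
  rw [hxy a (hA a b h hab).1, hxy b (hA a b h hab).2, ← hα, α.injective.ne_iff]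

/-- Given proper colourings `x` of `A₁` and `y` of `A₂`, an equivariant permutation makes `y` agree
with `x` on `V₁ ∩ V₂`, and the two are glued. What is left over, `y` on `V₁` and `x` elsewhere, is
constrained only on `V₁ ∩ V₂`. The twist depends only on restrictions to `V₁ ∩ V₂`, which the
exchange preserves, so the process is reversible. -/
theorem numProper_union_mul_numProper_complete {A₁ A₂ : GainRelation V G} {V₁ V₂ : Set V}
    (h₁ : ∀ a b h, A₁ a b h → a ∈ V₁ ∧ b ∈ V₁) (h₂ : ∀ a b h, A₂ a b h → a ∈ V₂ ∧ b ∈ V₂)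
    (hC₁ : ∀ a b h, complete (V₁ ∩ V₂) a b h → A₁ a b h)
    (hC₂ : ∀ a b h, complete (V₁ ∩ V₂) a b h → A₂ a b h) (k : ℕ) :
    (A₁.union A₂).numProper k * (complete (V₁ ∩ V₂) : GainRelation V G).numProper k =
      A₁.numProper k * A₂.numProper k := by
  classical
  have hex : ∀ x y : (V₁ ∩ V₂ : Set V) → G × Fin k, ∃ α : (G × Fin k) ≃ (G × Fin k),
      (∀ h s, α (shift h s) = shift h (α s)) ∧ ((Function.Injective fun c => (x c).2) →
        (Function.Injective fun c => (y c).2) → ∀ c, α (y c) = x c) := by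
    intro x y
    by_cases h : (Function.Injective fun c => (x c).2) ∧ (Function.Injective fun c => (y c).2)
    · obtain ⟨α, h1, h2⟩ := exists_equiv_of_injective x y h.1 h.2
      exact ⟨α, h1, fun _ _ => h2⟩
    -- Off the proper colourings of the intersection the twist is irrelevant; the identity keeps
    -- `twistedSwap` a bijection on all pairs.
    · exact ⟨Equiv.refl _, fun _ _ => rfl, fun hx hy => absurd ⟨hx, hy⟩ h⟩
  choose α hα hαC using hex
  let e := twistedSwap (T := G × Fin k) (Set.inter_subset_left (s := V₁) (t := V₂)) α
  unfold numProper
  rw [← Nat.card_prod, ← Nat.card_prod]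
  refine (Nat.card_congr ((Equiv.subtypeProdEquivProd.symm.trans
    (e.subtypeEquiv ?_)).trans Equiv.subtypeProdEquivProd)).symm
  rintro ⟨x, y⟩
  simp only [e, twistedSwap, Equiv.coe_fn_mk]
  set β := α (x ∘ (↑)) (y ∘ (↑)) with hβ
  have hβs := hα (x ∘ (↑)) (y ∘ (↑))
  rw [← hβ] at hβs
  have hon : ∀ a ∈ V₁, V₁.piecewise x (β ∘ y) a = x a := fun a ha => by simp [ha]
  have hcc : (complete (V₁ ∩ V₂) : GainRelation V G).IsProper (V₁.piecewise y x) ↔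
      (complete (V₁ ∩ V₂) : GainRelation V G).IsProper y := by
    refine isProper_congr (S := V₁ ∩ V₂) (fun a b h hab => ⟨hab.1, hab.2.1⟩) (Equiv.refl _)
      (fun _ _ => rfl) fun a ha => ?_
    simp [ha.1]
  have hA₁ : A₁.IsProper (V₁.piecewise x (β ∘ y)) ↔ A₁.IsProper x :=
    isProper_congr h₁ (Equiv.refl _) (fun _ _ => rfl) hon
  have hA₂ : (complete (V₁ ∩ V₂) : GainRelation V G).IsProper x →
      (complete (V₁ ∩ V₂) : GainRelation V G).IsProper y →
      (A₂.IsProper (V₁.piecewise x (β ∘ y)) ↔ A₂.IsProper y) := by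
    intro hx hy
    rw [isProper_complete_iff] at hx hy
    refine isProper_congr h₂ β hβs fun a ha => ?_
    by_cases ha₁ : a ∈ V₁
    · rw [hon a ha₁]
      exact (hαC (x ∘ (↑)) (y ∘ (↑)) hx hy ⟨a, ha₁, ha⟩).symm
    · simp [ha₁]
  rw [hcc]
  constructor
  · rintro ⟨hx, hy⟩
    have hCy := hy.mono hC₂
    have h2 := (hA₂ (hx.mono hC₁) hCy).2 hy
    exact ⟨fun a b h hab => hab.elim (hA₁.2 hx a b h) (h2 a b h), hCy⟩
  · rintro ⟨hx, hy⟩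
    have hx1 := hA₁.1 (hx.mono fun a b h hab => Or.inl hab)
    exact ⟨hx1, (hA₂ (hx1.mono hC₁) hy).1 (hx.mono fun a b h hab => Or.inr hab)⟩

theorem numProper_pos [Finite V] [Finite G] {A : GainRelation V G}
    (hA : ∀ a b h, A a b h → a ≠ b) {k : ℕ} (hk : Nat.card V ≤ k) : 0 < A.numProper k := by
  let e := Finite.equivFin V
  have : Nonempty {x : V → G × Fin k // A.IsProper x} := by
    refine ⟨⟨fun a => (0, Fin.castLE hk (e a)), fun a b h hab heq => hA a b h hab ?_⟩⟩
    have h2 := congrArg Prod.snd heq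
    simpa [shift] using h2
  exact Nat.card_pos

end Union

/-! ### Reductions of glued gain graphs -/

section Glue

theorem contract_of_adj {A : GainRelation V G} {f : V → V} {p : V → G} {S : Set V}
    (hA : ∀ a b h, A a b h → a ∈ S ∧ b ∈ S ∧ a ≠ b) (hf : ∀ a ∈ S, f a = a) (hp : ∀ a ∈ S, p a = 0)
    {B : GainRelation V G} (hAB : ∀ a b h, A a b h → B a b h) {a b : V} {h : G} (hab : A a b h) :
    B.contract f p a b h := by
  obtain ⟨ha, hb, hne⟩ := hA a b h hab
  refine ⟨hne, a, b, hf a ha, hf b hb, hAB _ _ _ ?_⟩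
  simpa [hp a ha, hp b hb] using hab

theorem elim_union {A₁ A₂ : GainRelation V G} {V₁ : Set V}
    (h₁ : ∀ a b h, A₁ a b h → a ∈ V₁ ∧ b ∈ V₁ ∧ a ≠ b) {u v : V} {g : G} (hv : v ∉ V₁) :
    (A₁.union A₂).elim u v g = A₁.union (A₂.elim u v g) := by
  classical
  have hf : ∀ a ∈ V₁, mergeMap u v a = a := fun a ha => by
    simp [mergeMap, show a ≠ v from fun h => hv (h ▸ ha)]
  have hp : ∀ a ∈ V₁, (Pi.single v (-g) : V → G) a = 0 := fun a ha => by
    simp [show a ≠ v from fun h => hv (h ▸ ha)]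
  funext a b h
  apply propext
  constructor
  · rintro ⟨hab, c, d, hc, hd, hA | hA⟩
    · left
      obtain ⟨hcV, hdV, -⟩ := h₁ _ _ _ hA
      rw [hf c hcV] at hc
      rw [hf d hdV] at hd
      subst hc hd
      simpa [hp _ hcV, hp _ hdV] using hA
    · exact Or.inr ⟨hab, c, d, hc, hd, hA⟩
  · rintro (hA | ⟨hab, c, d, hc, hd, hA⟩)
    · exact contract_of_adj h₁ hf hp (fun _ _ _ h => Or.inl h) hA
    · exact ⟨hab, c, d, hc, hd, Or.inr hA⟩

/-- The contractions of `A₂` onto `V₁ ∩ V₂` eliminate vertices outside `V₁`, so they leave `A₁`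
alone. Once `A₂` is complete on the intersection it is contained in `A₁`, and the reduction of `A₁`
takes over. -/
theorem ContractsOnto.union [Finite V] [Finite G] {W V₁ V₂ : Set V} {A₁ A₂ : GainRelation V G}
    (h₁ : ∀ a b h, A₁ a b h → a ∈ V₁ ∧ b ∈ V₁ ∧ a ≠ b)
    (hC₁ : ∀ a b h, complete (V₁ ∩ V₂) a b h → A₁ a b h) (hW : W ⊆ V₁)
    (hA₁ : ContractsOnto W A₁) (hA₂ : ContractsOnto (V₁ ∩ V₂) A₂)
    (h₂ : ∀ a b h, A₂ a b h → a ∈ V₂ ∧ b ∈ V₂)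
    (hC₂ : ∀ a b h, complete (V₁ ∩ V₂) a b h → A₂ a b h) : ContractsOnto W (A₁.union A₂) := by
  classical
  induction hA₂ with
  | of_complete A₂ h =>
    have : A₁.union A₂ = A₁ := by
      funext a b g
      refine propext ⟨fun hab => hab.elim id fun hab => hC₁ a b g ?_, Or.inl⟩
      rwa [h] at hab
    rwa [this]
  | elim A₂ u v g hv huv hA hdvd h ih =>
    obtain ⟨huV, hvV⟩ := h₂ _ _ _ hA
    have hv₁ : v ∉ V₁ := fun h => hv ⟨h, hvV⟩
    have h₂' : ∀ a b h, A₂.elim u v g a b h → a ∈ V₂ ∧ b ∈ V₂ := by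
      rintro a b h ⟨-, c, d, rfl, rfl, hcd⟩
      have := h₂ _ _ _ hcd
      unfold mergeMap
      constructor
      · split_ifs
        exacts [huV, this.1]
      · split_ifs
        exacts [huV, this.2]
    have hC₂' : ∀ a b h, complete (V₁ ∩ V₂) a b h → A₂.elim u v g a b h := by
      intro a b h hab
      refine contract_of_adj (A := complete (V₁ ∩ V₂)) (S := V₁ ∩ V₂) (fun _ _ _ h => h) ?_ ?_
        hC₂ hab
      · intro a ha
        simp [mergeMap, show a ≠ v from fun h => hv (h ▸ ha)]
      · intro a ha
        simp [show a ≠ v from fun h => hv (h ▸ ha)]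
    refine .elim _ u v g (fun h => hv₁ (hW h)) huv (Or.inr hA) ?_ ?_
    · rw [elim_union h₁ hv₁]
      obtain ⟨q, hq⟩ := hdvd
      refine ⟨q, fun k hk => ?_⟩
      have hpos := numProper_pos (V := V) (G := G) (A := complete (V₁ ∩ V₂))
        (fun a b h hab => hab.2.2) hk
      have e1 := numProper_union_mul_numProper_complete
        (fun a b h hab => ⟨(h₁ a b h hab).1, (h₁ a b h hab).2.1⟩) h₂ hC₁ hC₂ k
      have e2 := numProper_union_mul_numProper_complete
        (fun a b h hab => ⟨(h₁ a b h hab).1, (h₁ a b h hab).2.1⟩) h₂' hC₁ hC₂' k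
      have hq := hq k hk
      -- The product formula holds before and after the contraction with the same factor for the
      -- complete graph. This factor is nonzero because `k ≥ |V|`, which is why `CountDvd` has that
      -- bound.
      apply mul_right_cancel₀ (b := ((complete (V₁ ∩ V₂) : GainRelation V G).numProper k : ℤ))
        (by exact_mod_cast hpos.ne')
      zify at e1 e2
      linear_combination ((Nat.card G * k : ℕ) : ℤ) * e1 + (A₁.numProper k : ℤ) * hq -
        q.eval ((Nat.card G * k : ℕ) : ℤ) * e2
    · rw [elim_union h₁ hv₁]
      exact ih h₂' hC₂'

end Glue

end GainRelation

namespace GainRelation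

variable {V : Type u} {G : Type v} [AddCommGroup G]

/-! ### Link-simplicial vertices -/

section Simplicial

/-- Link simplicial vertices of a gain graph. -/
def IsSimplicial (A : GainRelation V G) (v : V) : Prop :=
  ∀ a b g h, a ≠ b → A a v g → A v b h → A a b (g + h)

variable {A : GainRelation V G} {v : V}

/-- Each edge at `v` forbids one colour. Two edges to distinct neighbours forbid different colours,
since otherwise `y` would be improper on the edge that simpliciality provides between the
neighbours; two edges to the same neighbour do so because the action is free. -/
theorem ncard_forbidden (hsymm : ∀ a b h, A a b h → A b a (-h)) (hne : ∀ a b h, A a b h → a ≠ b)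
    (hv : A.IsSimplicial v) {k : ℕ} {y : V → G × Fin k} (hy : (A.restrict {v}ᶜ).IsProper y) :
    Set.ncard {s | ∃ b h, A v b h ∧ s = shift h (y b)} = Nat.card {e : V × G // A v e.1 e.2} := by
  have hr : {s | ∃ b h, A v b h ∧ s = shift h (y b)} =
      Set.range fun e : {e : V × G // A v e.1 e.2} => shift e.1.2 (y e.1.1) := by
    ext s
    constructor
    · rintro ⟨b, h, hb, rfl⟩
      exact ⟨⟨(b, h), hb⟩, rfl⟩
    · rintro ⟨⟨⟨b, h⟩, hb⟩, rfl⟩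
      exact ⟨b, h, hb, rfl⟩
  rw [hr, ← Set.image_univ, Set.ncard_image_of_injective, Set.ncard_univ]
  rintro ⟨⟨b, h⟩, hb⟩ ⟨⟨b', h'⟩, hb'⟩ heq
  dsimp only at heq hb hb'
  by_cases hbb : b = b'
  · subst hbb
    rw [shift_left_inj] at heq
    subst heq
    rfl
  · exfalso
    refine hy b b' (-h + h') ⟨(hne _ _ _ hb).symm, (hne _ _ _ hb').symm,
      hv b b' _ _ hbb (hsymm _ _ _ hb) hb'⟩ ?_
    rw [← shift_shift, ← heq, shift_shift, neg_add_cancel, shift_zero]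

theorem isProper_update_iff [DecidableEq V] (hsymm : ∀ a b h, A a b h → A b a (-h))
    (hne : ∀ a b h, A a b h → a ≠ b) {k : ℕ} (y : V → G × Fin k) (s : G × Fin k) :
    A.IsProper (Function.update y v s) ↔
      (A.restrict {v}ᶜ).IsProper y ∧ s ∉ {s | ∃ b h, A v b h ∧ s = shift h (y b)} := by
  constructor
  · intro hx
    refine ⟨fun a b h hab heq => hx a b h hab.2.2 ?_, ?_⟩
    · rwa [Function.update_of_ne hab.1, Function.update_of_ne hab.2.1]
    · rintro ⟨b, h, hb, rfl⟩
      refine hx v b h hb ?_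
      rw [Function.update_self, Function.update_of_ne (hne _ _ _ hb).symm]
  · rintro ⟨hy, hs⟩ a b h hab heq
    by_cases ha : a = v
    · subst ha
      rw [Function.update_self, Function.update_of_ne (hne _ _ _ hab).symm] at heq
      exact hs ⟨b, h, hab, heq⟩
    · by_cases hb : b = v
      · subst hb
        rw [Function.update_self, Function.update_of_ne ha, shift_eq_iff] at heq
        exact hs ⟨a, -h, hsymm _ _ _ hab, heq.symm⟩
      · rw [Function.update_of_ne ha, Function.update_of_ne hb] at heq
        exact hy a b h ⟨ha, hb, hab⟩ heq

/-- In the graph without `v`, the vertex `v` is isolated and may have any colour. A proper colouring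
with a spare colour is therefore the same as a proper colouring of that graph with a permitted
colour for `v`: exchange the spare colour and the colour of `v`. -/
theorem IsSimplicial.mul_numProper [Finite V] [Finite G]
    (hsymm : ∀ a b h, A a b h → A b a (-h)) (hne : ∀ a b h, A a b h → a ≠ b)
    (hv : A.IsSimplicial v) (k : ℕ) :
    ((Nat.card G * k : ℕ) : ℤ) * A.numProper k =
      (((Nat.card G * k : ℕ) : ℤ) - Nat.card {e : V × G // A v e.1 e.2}) *
        (A.restrict {v}ᶜ).numProper k := by
  classical
  let F : (V → G × Fin k) → Set (G × Fin k) := fun y => {s | ∃ b h, A v b h ∧ s = shift h (y b)}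
  let e : {x : V → G × Fin k // A.IsProper x} × (G × Fin k) ≃
      Σ y : {y : V → G × Fin k // (A.restrict {v}ᶜ).IsProper y}, ((F y.1)ᶜ : Set (G × Fin k)) :=
    { toFun q := ⟨⟨Function.update q.1.1 v q.2, by
          have h := (isProper_update_iff (v := v) hsymm hne
            (Function.update q.1.1 v q.2) (q.1.1 v)).1 (by simpa using q.1.2)
          exact h.1⟩, ⟨q.1.1 v, by
          have h := (isProper_update_iff (v := v) hsymm hne
            (Function.update q.1.1 v q.2) (q.1.1 v)).1 (by simpa using q.1.2)
          exact h.2⟩⟩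
      invFun q := (⟨Function.update q.1.1 v q.2.1, by
          rw [isProper_update_iff hsymm hne]
          exact ⟨q.1.2, q.2.2⟩⟩, q.1.1 v)
      left_inv q := by
        refine Prod.ext (Subtype.ext ?_) ?_ <;> simp
      right_inv q := by
        obtain ⟨⟨y, hy⟩, ⟨s, hs⟩⟩ := q
        exact Sigma.subtype_ext (Subtype.ext (by simp)) (by simp) }
  have hcard := Nat.card_congr e
  have := Fintype.ofFinite {y : V → G × Fin k // (A.restrict {v}ᶜ).IsProper y}
  rw [Nat.card_prod, Nat.card_sigma, Nat.card_prod, Nat.card_eq_fintype_card (α := Fin k),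
    Fintype.card_fin] at hcard
  have hterm : ∀ y : {y : V → G × Fin k // (A.restrict {v}ᶜ).IsProper y},
      (Nat.card ((F y.1)ᶜ : Set (G × Fin k)) : ℤ) =
        ((Nat.card G * k : ℕ) : ℤ) - Nat.card {e : V × G // A v e.1 e.2} := by
    intro y
    have h1 : (F y.1).ncard + (F y.1)ᶜ.ncard = Nat.card (G × Fin k) :=
      Set.ncard_add_ncard_compl _
    have h2 : (F y.1).ncard = _ := ncard_forbidden hsymm hne hv y.2
    rw [Nat.card_prod, Nat.card_eq_fintype_card (α := Fin k), Fintype.card_fin] at h1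
    rw [Nat.card_coe_set_eq]
    omega
  have h3 := congrArg (Nat.cast : ℕ → ℤ) hcard
  rw [Nat.cast_mul, Nat.cast_sum, Finset.sum_congr rfl fun y _ => hterm y, Finset.sum_const,
    Finset.card_univ, ← Nat.card_eq_fintype_card, nsmul_eq_mul, mul_comm (Nat.cast _)] at h3
  unfold numProper
  rw [h3, mul_comm]

/-- The edges at `v`, moved to `u` by the contraction, are already edges at `u` by simpliciality. -/
theorem IsSimplicial.elim_eq_restrict (hsymm : ∀ a b h, A a b h → A b a (-h))
    (hne : ∀ a b h, A a b h → a ≠ b) (hv : A.IsSimplicial v) {u : V} {g : G} (hu : A u v g) :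
    A.elim u v g = A.restrict {v}ᶜ := by
  classical
  have huv : u ≠ v := hne _ _ _ hu
  funext a b h
  apply propext
  constructor
  · rintro ⟨hab, c, d, rfl, rfl, hA⟩
    have hm : ∀ c, mergeMap u v c ≠ v := by
      intro c
      unfold mergeMap
      split_ifs with h
      exacts [huv, h]
    refine ⟨hm c, hm d, ?_⟩
    by_cases hc : c = v
    · have hd : d ≠ v := fun hd => hab (by rw [hc, hd])
      subst hc
      simp only [mergeMap, if_true, hd, if_false, Pi.single_eq_same, ne_eq, not_false_eq_true,
        Pi.single_eq_of_ne, sub_zero] at hA hab ⊢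
      have := hv u d _ _ hab hu hA
      convert this using 1
      abel
    · by_cases hd : d = v
      · subst hd
        simp only [mergeMap, if_true, hc, if_false, Pi.single_eq_same, ne_eq, not_false_eq_true,
          Pi.single_eq_of_ne, add_zero] at hA hab ⊢
        have := hv c u _ _ hab hA (hsymm _ _ _ hu)
        convert this using 1
        abel
      · simpa [mergeMap, hc, hd] using hA
  · rintro ⟨ha, hb, hA⟩
    exact contract_of_adj (A := A.restrict {v}ᶜ) (S := {v}ᶜ)
      (fun a b h hab => ⟨hab.1, hab.2.1, hne _ _ _ hab.2.2⟩)
      (fun a ha => by simp [mergeMap, show a ≠ v from ha])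
      (fun a ha => by simp [show a ≠ v from ha]) (fun _ _ _ h => h.2.2) ⟨ha, hb, hA⟩

open Classical in
-- The same edge contracted in the other direction: now `u` becomes isolated and `v` plays its part,
-- after switching by `g`. This serves when `v` belongs to the set to be kept.
theorem IsSimplicial.elim_eq_relabel (hsymm : ∀ a b h, A a b h → A b a (-h))
    (hne : ∀ a b h, A a b h → a ≠ b) (hv : A.IsSimplicial v) {u : V} {g : G} (hu : A u v g) :
    A.elim v u (-g) = (A.restrict {v}ᶜ).relabel (Equiv.swap u v) (Pi.single v g) := by
  have huv : u ≠ v := hne _ _ _ hu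
  funext a b h
  apply propext
  constructor
  · rintro ⟨hab, c, d, rfl, rfl, hA⟩
    by_cases hc : c = u
    · have hd : d ≠ u := fun hd => hab (by rw [hc, hd])
      subst hc
      have hdv : d ≠ v := fun h => hab (by simp [mergeMap, h])
      simp only [neg_neg, Pi.single_eq_same, ne_eq, hd, not_false_eq_true, Pi.single_eq_of_ne,
        sub_zero] at hA
      simp only [relabel, mergeMap, if_true, hd, if_false, Equiv.swap_apply_right,
        Equiv.swap_apply_of_ne_of_ne hd hdv, Pi.single_eq_same, ne_eq, hdv, not_false_eq_true,
        Pi.single_eq_of_ne, sub_zero]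
      exact ⟨huv, hdv, hA⟩
    · by_cases hd : d = u
      · subst hd
        have hcv : c ≠ v := fun h => hab (by simp [mergeMap, h])
        simp only [neg_neg, Pi.single_eq_same, ne_eq, hc, not_false_eq_true, Pi.single_eq_of_ne,
          add_zero] at hA
        simp only [relabel, mergeMap, if_true, hc, if_false, Equiv.swap_apply_right,
          Equiv.swap_apply_of_ne_of_ne hc hcv, Pi.single_eq_same, ne_eq, hcv, not_false_eq_true,
          Pi.single_eq_of_ne, add_zero]
        exact ⟨hcv, huv, hA⟩
      · simp only [neg_neg, ne_eq, hc, hd, not_false_eq_true, Pi.single_eq_of_ne,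
          add_zero, sub_zero] at hA
        simp only [relabel, mergeMap, hc, hd, if_false]
        by_cases hcv : c = v
        · subst hcv
          have hdv : d ≠ c := (hne _ _ _ hA).symm
          simp only [Equiv.swap_apply_right, Equiv.swap_apply_of_ne_of_ne hd hdv,
            Pi.single_eq_same, ne_eq, hdv, not_false_eq_true, Pi.single_eq_of_ne, sub_zero]
          refine ⟨huv, hdv, ?_⟩
          have := hv u d _ _ (Ne.symm hd) hu hA
          rwa [add_comm] at this
        · by_cases hdv : d = v
          · subst hdv
            simp only [Equiv.swap_apply_right, Equiv.swap_apply_of_ne_of_ne hc hcv,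
              Pi.single_eq_same, ne_eq, hcv, not_false_eq_true, Pi.single_eq_of_ne, add_zero]
            refine ⟨hcv, huv, ?_⟩
            have := hv c u _ _ hc hA (hsymm _ _ _ hu)
            rwa [← sub_eq_add_neg] at this
          · simp only [Equiv.swap_apply_of_ne_of_ne hd hdv, Equiv.swap_apply_of_ne_of_ne hc hcv,
              ne_eq, hcv, hdv, not_false_eq_true, Pi.single_eq_of_ne, add_zero, sub_zero]
            exact ⟨hcv, hdv, hA⟩
  · rintro ⟨ha, hb, hA⟩
    have hau : a ≠ u := fun h => ha (by simp [h])
    have hbu : b ≠ u := fun h => hb (by simp [h])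
    have hab : a ≠ b := fun h => hne _ _ _ hA (by rw [h])
    refine ⟨hab, Equiv.swap u v a, Equiv.swap u v b, ?_, ?_, ?_⟩
    · by_cases hav : a = v
      · simp [mergeMap, hav]
      · simp [mergeMap, Equiv.swap_apply_of_ne_of_ne hau hav, hau]
    · by_cases hbv : b = v
      · simp [mergeMap, hbv]
      · simp [mergeMap, Equiv.swap_apply_of_ne_of_ne hbu hbv, hbu]
    · have hs : ∀ c, c ≠ u → (Pi.single u (- -g) : V → G) (Equiv.swap u v c) =
          (Pi.single v g : V → G) c := by
        intro c hc
        by_cases hcv : c = v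
        · simp [hcv]
        · simp [Equiv.swap_apply_of_ne_of_ne hc hcv, hc, hcv]
      rwa [hs a hau, hs b hbu]

/-- If `v ∉ W`, contract an edge at `v` if there is one. If `v ∈ W` has a neighbour `u ∉ W`,
contract `u` into `v`; the result is the graph without `v`, in which `u` takes the place of `v` in
`W`. If all neighbours of `v ∈ W` lie in `W`, the graph is the union of the complete graph on `W`
and the graph without `v`, glued along `W \ {v}`. -/
theorem IsSimplicial.contractsOnto [Finite V] [Finite G]
    (hsymm : ∀ a b h, A a b h → A b a (-h)) (hne : ∀ a b h, A a b h → a ≠ b)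
    (hv : A.IsSimplicial v)
    (ih : ∀ W : Set V, (∀ a b h, complete W a b h → A.restrict {v}ᶜ a b h) →
      ContractsOnto W (A.restrict {v}ᶜ))
    {W : Set V} (hW : ∀ a b h, complete W a b h → A a b h) : ContractsOnto W A := by
  classical
  have hq : ∀ k : ℕ, ((Nat.card G * k : ℕ) : ℤ) * A.numProper k =
      (X - C (Nat.card {e : V × G // A v e.1 e.2} : ℤ)).eval ((Nat.card G * k : ℕ) : ℤ) *
        (A.restrict {v}ᶜ).numProper k := by
    intro k
    rw [hv.mul_numProper hsymm hne k, eval_sub, eval_X, eval_C]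
  by_cases hvW : v ∈ W
  · by_cases hN : ∃ u g, A u v g ∧ u ∉ W
    · obtain ⟨u, g, hu, huW⟩ := hN
      have huv := hne _ _ _ hu
      refine .elim A v u (-g) huW huv.symm (hsymm _ _ _ hu)
        ⟨X - C (Nat.card {e : V × G // A v e.1 e.2} : ℤ), fun k _ => ?_⟩ ?_
      · rw [hv.elim_eq_relabel hsymm hne hu, numProper_relabel]
        exact hq k
      · rw [hv.elim_eq_relabel hsymm hne hu]
        have hpre : W = Equiv.swap u v ⁻¹' (insert u (W \ {v})) := by
          ext a
          by_cases hau : a = u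
          · subst hau
            simp [huW, huv.symm]
          · by_cases hav : a = v
            · subst hav
              simp [hvW]
            · simp [Equiv.swap_apply_of_ne_of_ne hau hav, hau, hav]
        rw [hpre]
        refine (ih _ ?_).relabel _ _
        rintro a b h ⟨ha, hb, hab⟩
        have hvn : ∀ a, a ∈ insert u (W \ {v}) → a ∈ ({v}ᶜ : Set V) := by
          rintro a (rfl | ha)
          exacts [huv, ha.2]
        refine ⟨hvn a ha, hvn b hb, ?_⟩
        -- As `v` is joined to `w` with every gain, simpliciality at `v` joins `u` to `w` with every
        -- gain.
        have hub : ∀ w ∈ W \ {v}, ∀ h, A u w h := by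
          intro w hw h
          have := hv u w g (-g + h) (fun e => huW (e ▸ hw.1)) hu
            (hW v w _ ⟨hvW, hw.1, fun e => hw.2 e.symm⟩)
          simpa using this
        rcases ha with rfl | ha
        · rcases hb with rfl | hb
          · exact absurd rfl hab
          · exact hub b hb h
        · rcases hb with rfl | hb
          · simpa using hsymm _ _ _ (hub a ha (-h))
          · exact hW a b h ⟨ha.1, hb.1, hab⟩
    · push Not at hN
      have hA : A = (complete W).union (A.restrict {v}ᶜ) := by
        funext a b h
        refine propext ⟨fun hab => ?_, fun hab => hab.elim (hW a b h) fun h => h.2.2⟩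
        by_cases ha : a = v
        · subst ha
          exact Or.inl ⟨hvW, hN b _ (hsymm _ _ _ hab), hne _ _ _ hab⟩
        · by_cases hb : b = v
          · subst hb
            exact Or.inl ⟨hN a _ hab, hvW, hne _ _ _ hab⟩
          · exact Or.inr ⟨ha, hb, hab⟩
      have hres : ∀ a b h, complete (W ∩ {v}ᶜ) a b h → A.restrict {v}ᶜ a b h :=
        fun a b h hab => ⟨hab.1.2, hab.2.1.2, hW a b h ⟨hab.1.1, hab.2.1.1, hab.2.2⟩⟩
      rw [hA]
      exact ContractsOnto.union (V₁ := W) (V₂ := {v}ᶜ) (fun _ _ _ h => h)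
        (fun a b h hab => ⟨hab.1.1, hab.2.1.1, hab.2.2⟩) subset_rfl (.of_complete _ rfl)
        (ih _ hres) (fun a b h hab => ⟨hab.1, hab.2.1⟩) hres
  · have hih : ContractsOnto W (A.restrict {v}ᶜ) := by
      refine ih W fun a b h hab => ⟨fun e => hvW ?_, fun e => hvW ?_, hW a b h hab⟩
      · exact (show a = v from e) ▸ hab.1
      · exact (show b = v from e) ▸ hab.2.1
    by_cases hN : ∃ u g, A u v g
    · obtain ⟨u, g, hu⟩ := hN
      have he := hv.elim_eq_restrict hsymm hne hu
      refine .elim A u v g hvW (hne _ _ _ hu) hu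
        ⟨X - C (Nat.card {e : V × G // A v e.1 e.2} : ℤ), fun k _ => ?_⟩ (he ▸ hih)
      rw [he]
      exact hq k
    · push Not at hN
      have hA : A.restrict {v}ᶜ = A := by
        funext a b h
        refine propext ⟨fun h => h.2.2, fun hab => ⟨?_, ?_, hab⟩⟩
        · rintro rfl
          exact hN _ _ (hsymm _ _ _ hab)
        · rintro rfl
          exact hN _ _ hab
      rwa [hA] at hih

end Simplicial

/-! ### Reductions of the graphs in the class -/

section Class

/-- The image of a gain graph under a map of the vertices. -/
def map {V' : Type u} (A : GainRelation V G) (f : V → V') : GainRelation V' G :=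
  fun a b h => ∃ c d, f c = a ∧ f d = b ∧ A c d h

/-- The restriction of a map to the vertices of an induced subgraph. -/
def inducedMap {V' : Type u} (Γ : LooplessGainGraph.{u} G) (f : Γ.V → V') (S : Set Γ.V) :
    (Γ.induce S).V → V' := fun a : S => f a

theorem inducedMap_injective {V' : Type u} {Γ : LooplessGainGraph.{u} G} {f : Γ.V → V'}
    (hf : Function.Injective f) (S : Set Γ.V) : Function.Injective (inducedMap Γ f S) :=
  hf.comp Subtype.val_injective

theorem map_inducedMap {V' : Type u} {Γ : LooplessGainGraph.{u} G} {f : Γ.V → V'}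
    (hf : Function.Injective f) (S : Set Γ.V) :
    map (Γ.induce S).Adj (inducedMap Γ f S) = (map Γ.Adj f).restrict (f '' S) := by
  funext a b h
  apply propext
  constructor
  · rintro ⟨c, d, rfl, rfl, hcd⟩
    exact ⟨⟨c.1, c.2, rfl⟩, ⟨d.1, d.2, rfl⟩, c.1, d.1, rfl, rfl, hcd⟩
  · rintro ⟨⟨c, hc, rfl⟩, ⟨d, hd, rfl⟩, c', d', hc', hd', hcd⟩
    obtain rfl := hf hc'
    obtain rfl := hf hd'
    exact ⟨⟨c', hc⟩, ⟨d', hd⟩, rfl, rfl, hcd⟩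

/-- Gluing two gain graphs along a complete one. -/
theorem contractsOnto_of_glue [Finite V] [Finite G] {A : GainRelation V G} {V₁ V₂ W : Set V}
    (hne : ∀ a b h, A a b h → a ≠ b)
    (hE : ∀ a b h, A a b h → (a ∈ V₁ ∧ b ∈ V₁) ∨ (a ∈ V₂ ∧ b ∈ V₂))
    (hC : ∀ a b h, complete (V₁ ∩ V₂) a b h → A a b h)
    (hW : ∀ a b h, complete W a b h → A a b h) (hWV : ∀ a ∈ W, a ∈ V₂ → a ∈ V₁)
    (ih₁ : ∀ W : Set V, (∀ a b h, complete W a b h → A.restrict V₁ a b h) →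
      ContractsOnto W (A.restrict V₁))
    (ih₂ : ∀ W : Set V, (∀ a b h, complete W a b h → A.restrict V₂ a b h) →
      ContractsOnto W (A.restrict V₂)) : ContractsOnto W A := by
  have hA : A = (A.restrict V₁).union (A.restrict V₂) := by
    funext a b h
    refine propext ⟨fun hab => ?_, fun hab => hab.elim (fun h => h.2.2) fun h => h.2.2⟩
    exact (hE a b h hab).imp (fun h => ⟨h.1, h.2, hab⟩) fun h => ⟨h.1, h.2, hab⟩
  have hCeq : (V₁ ∪ V₂ᶜ) ∩ V₂ = V₁ ∩ V₂ := by
    rw [Set.union_inter_distrib_right, Set.compl_inter_self, Set.union_empty]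
  have hC₂ : ∀ a b h, complete (V₁ ∩ V₂) a b h → A.restrict V₂ a b h :=
    fun a b h hab => ⟨hab.1.2, hab.2.1.2, hC a b h hab⟩
  have hW₁ : ∀ a b h, complete W a b h → A.restrict V₁ a b h := by
    intro a b h hab
    have h1 := hW a b h hab
    rcases hE a b h h1 with h2 | h2
    · exact ⟨h2.1, h2.2, h1⟩
    · exact ⟨hWV a hab.1 h2.1, hWV b hab.2.1 h2.2, h1⟩
  rw [hA]
  -- Adding the complement of `V₂` to the first side leaves the intersection unchanged and makes the
  -- side contain `W`, which may have a vertex outside both sides.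
  refine ContractsOnto.union (V₁ := V₁ ∪ V₂ᶜ) (V₂ := V₂)
    (fun a b h hab => ⟨Or.inl hab.1, Or.inl hab.2.1, hne _ _ _ hab.2.2⟩) ?_ ?_ (ih₁ W hW₁) ?_
    (fun a b h hab => ⟨hab.1, hab.2.1⟩) ?_
  · rw [hCeq]
    exact fun a b h hab => ⟨hab.1.1, hab.2.1.1, hC a b h hab⟩
  · intro a ha
    by_cases h : a ∈ V₂
    exacts [Or.inl (hWV a ha h), Or.inr h]
  · rw [hCeq]
    exact ih₂ _ hC₂
  · rwa [hCeq]

/-- All graphs of the induction are embedded in one vertex type `V`, whose other vertices are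
isolated, so that induced subgraphs and contractions can be compared. The set `W` is arbitrary
because gluing requires reductions onto the common complete subgraph. -/
theorem contractsOnto_of_extendedLiftClass [Finite G] {Γ : LooplessGainGraph.{u} G}
    (hΓ : LooplessGainGraph.ExtendedLiftClass G Γ) {V : Type u} [Finite V] (f : Γ.V → V)
    (hf : Function.Injective f) (W : Set V)
    (hW : ∀ a b h, complete W a b h → map Γ.Adj f a b h) :
    ContractsOnto W (map Γ.Adj f) := by
  have hsymm : ∀ (Γ : LooplessGainGraph.{u} G) (f : Γ.V → V),
      ∀ a b h, map Γ.Adj f a b h → map Γ.Adj f b a (-h) := by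
    rintro Γ f a b h ⟨c, d, rfl, rfl, hcd⟩
    exact ⟨d, c, rfl, rfl, Γ.symm hcd⟩
  have hne : ∀ (Γ : LooplessGainGraph.{u} G) (f : Γ.V → V), Function.Injective f →
      ∀ a b h, map Γ.Adj f a b h → a ≠ b := by
    rintro Γ f hf a b h ⟨c, d, rfl, rfl, hcd⟩ heq
    exact Γ.ne_of_adj hcd (hf heq)
  induction hΓ generalizing W with
  | null Γ h =>
    refine .of_complete _ ?_
    funext a b g
    refine propext ⟨?_, hW a b g⟩
    rintro ⟨c, -⟩
    exact h.elim c
  | linkSimplicial Γ v hv h ih =>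
    have hr : map (Γ.induce {v}ᶜ).Adj (inducedMap Γ f {v}ᶜ) =
        (map Γ.Adj f).restrict {f v}ᶜ := by
      rw [map_inducedMap hf]
      funext a b g
      apply propext
      constructor
      · rintro ⟨⟨c, hc, rfl⟩, ⟨d, hd, rfl⟩, hcd⟩
        exact ⟨fun h => hc (hf h), fun h => hd (hf h), hcd⟩
      · rintro ⟨ha, hb, c, d, rfl, rfl, hcd⟩
        exact ⟨⟨c, fun h => ha (congrArg f h), rfl⟩, ⟨d, fun h => hb (congrArg f h), rfl⟩,
          c, d, rfl, rfl, hcd⟩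
    have hs : (map Γ.Adj f).IsSimplicial (f v) := by
      rintro a b g g' hab ⟨c, d, rfl, hd, hcd⟩ ⟨c', d', hc', rfl, hcd'⟩
      obtain rfl := hf hd
      obtain rfl := hf hc'
      exact ⟨c, d', rfl, rfl, hv c d' g g' (fun h => hab (congrArg f h)) hcd hcd'⟩
    refine hs.contractsOnto (hsymm Γ f) (hne Γ f hf) (fun W hW => ?_) hW
    have := ih _ (inducedMap_injective hf _) W
    rw [hr] at this
    exact this hW
  | glue Γ V₁ V₂ hV h₁ h₂ hE n hn ih₁ ih₂ =>
    have hI₁ : ∀ W : Set V, (∀ a b h, complete W a b h →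
        (map Γ.Adj f).restrict (f '' V₁) a b h) →
        ContractsOnto W ((map Γ.Adj f).restrict (f '' V₁)) := by
      intro W hW
      have := ih₁ _ (inducedMap_injective hf _) W
      rw [map_inducedMap hf] at this
      exact this hW
    have hI₂ : ∀ W : Set V, (∀ a b h, complete W a b h →
        (map Γ.Adj f).restrict (f '' V₂) a b h) →
        ContractsOnto W ((map Γ.Adj f).restrict (f '' V₂)) := by
      intro W hW
      have := ih₂ _ (inducedMap_injective hf _) W
      rw [map_inducedMap hf] at this
      exact this hW
    have hE' : ∀ a b h, map Γ.Adj f a b h →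
        (a ∈ f '' V₁ ∧ b ∈ f '' V₁) ∨ (a ∈ f '' V₂ ∧ b ∈ f '' V₂) := by
      rintro a b h ⟨c, d, rfl, rfl, hcd⟩
      exact (hE c d h hcd).imp (fun h => ⟨⟨c, h.1, rfl⟩, ⟨d, h.2, rfl⟩⟩)
        fun h => ⟨⟨c, h.1, rfl⟩, ⟨d, h.2, rfl⟩⟩
    have hC : ∀ a b h, complete (f '' V₁ ∩ f '' V₂) a b h → map Γ.Adj f a b h := by
      rw [← Set.image_inter hf]
      rintro a b h ⟨⟨c, hc, rfl⟩, ⟨d, hd, rfl⟩, hab⟩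
      obtain ⟨e⟩ := hn
      refine ⟨c, d, rfl, rfl, (e.adj_iff ⟨c, hc⟩ ⟨d, hd⟩ h).1 ?_⟩
      intro h
      have := e.toEquiv.injective h
      exact hab (congrArg f (congrArg Subtype.val this))
    by_cases hcase : ∀ a ∈ W, a ∈ f '' V₂ → a ∈ f '' V₁
    · exact contractsOnto_of_glue (hne Γ f hf) hE' hC hW hcase hI₁ hI₂
    · push Not at hcase
      obtain ⟨w, hwW, hw₂, hw₁⟩ := hcase
      refine contractsOnto_of_glue (V₁ := f '' V₂) (V₂ := f '' V₁) (hne Γ f hf)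
        (fun a b h hab => (hE' a b h hab).symm) ?_ hW ?_ hI₂ hI₁
      · rwa [Set.inter_comm]
      · intro a ha ha₁
        have haw : a ≠ w := fun h => hw₁ (h ▸ ha₁)
        -- The edge joining `a` and `w` lies within one side, and `w` is not in the first; hence `W`
        -- meets the first side only inside the second, and the sides can be exchanged. The gain `0`
        -- is an arbitrary choice.
        rcases hE' a w 0 (hW a w 0 ⟨ha, hwW, haw⟩) with h | h
        exacts [absurd h.2 hw₁, h.1]

end Class

end GainRelation

/-! ### Rank and flats of an arrangement -/

namespace Arrangement

variable {K : Type u} {W : Type v} [Field K] [AddCommGroup W] [Module K W] [FiniteDimensional K W]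

theorem sInf_eq_of_isBasis (A : Arrangement K W) {I F : Set (Submodule K W)}
    (hI : A.matroid.IsBasis I F) : sInf I = sInf F := by
  refine le_antisymm (le_sInf fun H hH => ?_) (sInf_le_sInf hI.subset)
  by_contra hle
  have hHI : H ∉ I := fun h => hle (sInf_le h)
  have hHE : H ∈ A.carrier := hI.subset_ground hH
  obtain ⟨hIE, hIc⟩ := (A.matroid_indep_iff I).1 hI.indep
  refine hHI (hI.mem_of_insert_indep hH ((A.matroid_indep_iff _).2
    ⟨Set.insert_subset hHE hIE, ?_⟩))
  rw [sInf_insert, Set.ncard_insert_of_notMem hHI (A.finite.subset hIE)]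
  have h1 := codim_inf_le (P := sInf I) (A.codim_eq_one H hHE)
  have h2 := codim_inf_lt hle
  omega

theorem eRk_eq_codim (A : Arrangement K W) {F : Set (Submodule K W)} (hF : F ⊆ A.carrier) :
    A.matroid.eRk F = (Module.finrank K (W ⧸ sInf F) : ℕ) := by
  obtain ⟨I, hI⟩ := A.matroid.exists_isBasis F hF
  obtain ⟨hIE, hIc⟩ := (A.matroid_indep_iff I).1 hI.indep
  rw [hI.eRk_eq_encard, ← A.sInf_eq_of_isBasis hI, hIc,
    (A.finite.subset hIE).cast_ncard_eq]

theorem isFlat_setOf_le (A : Arrangement K W) (L : Submodule K W) :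
    A.matroid.IsFlat {H | H ∈ A.carrier ∧ L ≤ H} := by
  refine ⟨fun I X hI hX H hH => ⟨hX.subset_ground hH, ?_⟩, fun H hH => hH.1⟩
  have h1 := (A.sInf_eq_of_isBasis hI).symm.trans (A.sInf_eq_of_isBasis hX)
  exact (le_sInf fun H hH => hH.2).trans (h1.le.trans (sInf_le hH))

end Arrangement

/-! ### Subspaces attached to colourings -/

section Points

/-- The vector with coordinates `z` and `y`. -/
def consVector {K : Type v} {V : Type u} (z : K) (y : V → K) : Option V → K := fun o => o.elim z y

@[simp] theorem consVector_none {K : Type v} {V : Type u} (z : K) (y : V → K) : consVector z y none = z := rfl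

@[simp] theorem consVector_some {K : Type v} {V : Type u} (z : K) (y : V → K) (a : V) :
    consVector z y (some a) = y a := rfl

variable {K : Type v} [Field K] {G : AddSubgroup K} {V : Type u}

/-- The vectors with `y a - y b = h z` whenever `R a b h`. -/
def gainSubmodule (R : V → V → K → Prop) : Submodule K (Option V → K) where
  carrier := {y | ∀ a b h, R a b h → y (some a) - y (some b) = h * y none}
  add_mem' {y y'} hy hy' a b h hab := by
    simp only [Pi.add_apply]
    linear_combination hy a b h hab + hy' a b h hab
  zero_mem' a b h _ := by simp
  smul_mem' c y hy a b h hab := by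
    simp only [Pi.smul_apply, smul_eq_mul]
    linear_combination c * hy a b h hab

/-- The linear span of the points with finite part `x`. -/
def finitePoint {k : ℕ} (x : V → G × Fin k) : Submodule K (Option V → K) :=
  gainSubmodule fun a b h => (x a).2 = (x b).2 ∧ h = ((x a).1 : K) - (x b).1

/-- The linear span of the points at infinity that are constant on the fibres of `x`. -/
def infinitePoint {k : ℕ} (x : V → G × Fin k) : Submodule K (Option V → K) :=
  hyperplaneAtInfinity K V ⊓ gainSubmodule fun a b h => x a = x b ∧ h = 0

theorem consVector_mem_finitePoint {k : ℕ} (x : V → G × Fin k) :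
    consVector 1 (fun a => ((x a).1 : K)) ∈ finitePoint x := by
  rintro a b h ⟨-, rfl⟩
  simp

theorem not_finitePoint_le_hyperplaneAtInfinity {k : ℕ} (x : V → G × Fin k) :
    ¬ finitePoint x ≤ hyperplaneAtInfinity K V := by
  intro h
  have := h (consVector_mem_finitePoint x)
  rw [mem_hyperplaneAtInfinity] at this
  simp at this

/-- Lying on an edge hyperplane is exactly the failure of properness on that edge. The indicator of
a class of vertices with equal `Fin k` coordinate, with `z = 0`, belongs to the subspace and
separates vertices in different classes; within a class the vector with `z = 1` determines the gain.
-/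
theorem finitePoint_le_edgeHyperplane_iff {k : ℕ} (x : V → G × Fin k) (a b : V) (h : G) :
    finitePoint x ≤ edgeHyperplane a b (h : K) ↔ x a = GainRelation.shift h (x b) := by
  classical
  constructor
  · intro hle
    have h1 := hle (consVector_mem_finitePoint x)
    rw [mem_edgeHyperplane] at h1
    simp only [consVector_some, consVector_none, mul_one] at h1
    have h2 : (x a).2 = (x b).2 := by
      by_contra hne
      have hy : consVector 0 (fun c => if (x c).2 = (x a).2 then (1 : K) else 0) ∈
          finitePoint x := by
        rintro c d h ⟨hcd, -⟩
        simp [hcd]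
      have h3 := hle hy
      rw [mem_edgeHyperplane] at h3
      simp [Ne.symm hne] at h3
    refine Prod.ext (Subtype.ext ?_) h2
    simp only [GainRelation.shift, AddSubgroup.coe_add]
    linear_combination h1
  · intro heq y hy
    rw [mem_edgeHyperplane]
    refine hy a b h ⟨by rw [heq]; rfl, ?_⟩
    rw [heq]
    simp [GainRelation.shift]

theorem infinitePoint_le_edgeHyperplane_iff {k : ℕ} (x : V → G × Fin k) (a b : V) (h : K) :
    infinitePoint x ≤ edgeHyperplane a b h ↔ x a = x b := by
  classical
  constructor
  · intro hle
    by_contra hne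
    have hy : consVector 0 (fun c => if x c = x a then (1 : K) else 0) ∈ infinitePoint x := by
      refine ⟨rfl, ?_⟩
      rintro c d h ⟨hcd, -⟩
      simp [hcd]
    have h3 := hle hy
    rw [mem_edgeHyperplane] at h3
    simp [Ne.symm hne] at h3
  · rintro heq y ⟨hy0, hy⟩
    rw [mem_edgeHyperplane]
    have h1 := hy a b 0 ⟨heq, rfl⟩
    rw [(mem_hyperplaneAtInfinity y).1 hy0] at h1 ⊢
    simpa using h1

end Points

/-! ### Two counting tools -/

section Counting

/-- Functions compatible with a relation are functions on the quotient. -/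
def quotFunEquiv {V : Type u} (T : Type v) (r : V → V → Prop) :
    {x : V → T // ∀ a b, r a b → x a = x b} ≃ (Quot r → T) where
  toFun x := Quot.lift x.1 x.2
  invFun y := ⟨fun a => y (Quot.mk r a), fun a b h => congrArg y (Quot.sound h)⟩
  left_inv x := rfl
  right_inv y := by
    funext q
    induction q using Quot.ind
    rfl

theorem Nat.card_subtype_prod_ite {Z : Type u} {X : Type v} [Finite Z] [Finite X] (z₀ : Z)
    {P : Z × X → Prop} {P₀ P₁ : X → Prop} (h₀ : ∀ x, P (z₀, x) ↔ P₀ x)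
    (h₁ : ∀ z x, z ≠ z₀ → (P (z, x) ↔ P₁ x)) :
    Nat.card {ω // P ω} = Nat.card {x // P₀ x} + (Nat.card Z - 1) * Nat.card {x // P₁ x} := by
  classical
  have e : {ω // P ω} ≃ {x // P₀ x} ⊕ ({z // z ≠ z₀} × {x // P₁ x}) :=
    { toFun ω := if h : ω.1.1 = z₀ then
          Sum.inl ⟨ω.1.2, (h₀ _).1 (by rw [← h]; exact ω.2)⟩
        else Sum.inr (⟨ω.1.1, h⟩, ⟨ω.1.2, (h₁ _ _ h).1 ω.2⟩)
      invFun s := s.elim (fun x => ⟨(z₀, x.1), (h₀ _).2 x.2⟩)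
        fun q => ⟨(q.1.1, q.2.1), (h₁ _ _ q.1.2).2 q.2.2⟩
      left_inv := by
        rintro ⟨⟨z, x⟩, h⟩
        by_cases hz : z = z₀
        · subst hz
          simp
        · simp [hz]
      right_inv := by
        rintro (x | ⟨⟨z, hz⟩, x⟩)
        · simp
        · simp [hz] }
  have hz : Nat.card {z // z ≠ z₀} = Nat.card Z - 1 := by
    have := Fintype.ofFinite Z
    rw [Nat.card_eq_fintype_card, Nat.card_eq_fintype_card, Fintype.card_subtype_compl,
      Fintype.card_subtype_eq]
  rw [Nat.card_congr e, Nat.card_sum, Nat.card_prod, hz]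

end Counting

/-! ### Counting the points on the flats -/

namespace LooplessGainGraph

variable {K : Type v} [Field K] {G : AddSubgroup K} (Γ : LooplessGainGraph.{u} G)

/-- The subspace represented by a pair of a scalar and a colouring: the points at infinity
correspond to the scalar `z₀`. -/
noncomputable def pointSubmodule {k : ℕ} (z₀ : G × Fin k)
    (ω : (G × Fin k) × (Γ.V → G × Fin k)) : Submodule K (Option Γ.V → K) :=
  open Classical in if ω.1 = z₀ then infinitePoint ω.2 else finitePoint ω.2

theorem hyperplaneAtInfinity_mem : hyperplaneAtInfinity K Γ.V ∈ Γ.extendedLiftArrangement.carrier :=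
  Or.inl rfl

variable {Γ} in
theorem edgeHyperplane_mem {a b : Γ.V} {h : G} (hab : Γ.Adj a b h) :
    edgeHyperplane a b (h : K) ∈ Γ.extendedLiftArrangement.carrier :=
  Or.inr ⟨a, b, h, hab, rfl⟩

theorem infinitePoint_le_iff {F : Set (Submodule K (Option Γ.V → K))}
    (hF : F ⊆ Γ.extendedLiftArrangement.carrier) {k : ℕ} (x : Γ.V → G × Fin k) :
    (∀ H ∈ F, infinitePoint x ≤ H) ↔
      ∀ a b, (∃ h : G, Γ.Adj a b h ∧ edgeHyperplane a b (h : K) ∈ F) → x a = x b := by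
  constructor
  · rintro hx a b ⟨h, -, hmem⟩
    exact (infinitePoint_le_edgeHyperplane_iff x a b _).1 (hx _ hmem)
  · intro hx H hH
    rcases hF hH with rfl | ⟨a, b, h, hab, rfl⟩
    · exact inf_le_left
    · exact (infinitePoint_le_edgeHyperplane_iff x a b _).2 (hx a b ⟨h, hab, hH⟩)

/-- Potentials with values in the base field of a balanced set of edges can be chosen
in the gain group. -/
theorem exists_potential {V : Type u} (r : V → V → G → Prop) (q : V → K)
    (hq : ∀ a b h, r a b h → q a - q b = h) :
    ∃ p : V → G, ∀ a b h, r a b h → p a - p b = h := by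
  let s : V → V → Prop := fun a b => ∃ h, r a b h
  let φ : V → K ⧸ G := fun a => (q a : K ⧸ G)
  have hφ : ∀ a b, s a b → φ a = φ b := by
    rintro a b ⟨h, hab⟩
    refine (QuotientAddGroup.eq).2 ?_
    have := hq a b h hab
    have h2 : -q a + q b = -(h : K) := by linear_combination -this
    rw [h2]
    exact G.neg_mem h.2
  -- Modulo `G` the potential is constant on each component; subtracting its value at a
  -- representative of the component brings it into `G`.
  have hmem : ∀ a, q a - q (Quot.mk s a).out ∈ G := by
    intro a
    have h1 : φ (Quot.mk s a).out = φ a := by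
      change Quot.lift φ hφ (Quot.mk s (Quot.mk s a).out) = Quot.lift φ hφ (Quot.mk s a)
      rw [Quot.out_eq]
    have h2 := (QuotientAddGroup.eq).1 h1
    rwa [neg_add_eq_sub] at h2
  refine ⟨fun a => ⟨_, hmem a⟩, fun a b h hab => Subtype.ext ?_⟩
  have h1 : Quot.mk s a = Quot.mk s b := Quot.sound ⟨h, hab⟩
  simp only [AddSubgroup.coe_sub, h1]
  linear_combination hq a b h hab

theorem finrank_sInf_of_le {F : Set (Submodule K (Option Γ.V → K))}
    (hF : F ⊆ Γ.extendedLiftArrangement.carrier) (hle : sInf F ≤ hyperplaneAtInfinity K Γ.V) :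
    Module.finrank K (sInf F : Submodule K (Option Γ.V → K)) = Nat.card (Quot fun a b =>
      ∃ h : G, Γ.Adj a b h ∧ edgeHyperplane a b (h : K) ∈ F) := by
  set r : Γ.V → Γ.V → Prop := fun a b => ∃ h : G, Γ.Adj a b h ∧ edgeHyperplane a b (h : K) ∈ F
  have := Fintype.ofFinite (Quot r)
  let φ : (Quot r → K) →ₗ[K] (Option Γ.V → K) :=
    { toFun c := consVector 0 fun a => c (Quot.mk r a)
      map_add' c c' := by
        funext o
        cases o <;> simp [consVector]
      map_smul' s c := by
        funext o
        cases o <;> simp [consVector] }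
  have hinj : Function.Injective φ := by
    intro c c' h
    funext q
    induction q using Quot.ind with
    | mk a => exact congrFun h (some a)
  have hrange : LinearMap.range φ = sInf F := by
    ext y
    rw [LinearMap.mem_range, Submodule.mem_sInf]
    constructor
    · rintro ⟨c, rfl⟩ H hH
      rcases hF hH with rfl | ⟨a, b, h, hab, rfl⟩
      · exact (mem_hyperplaneAtInfinity _).2 rfl
      · rw [mem_edgeHyperplane]
        have : Quot.mk r a = Quot.mk r b := Quot.sound ⟨h, hab, hH⟩
        simp [φ, this]
    · intro hy
      have h0 : y none = 0 := (mem_hyperplaneAtInfinity y).1 (hle (Submodule.mem_sInf.2 hy))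
      refine ⟨Quot.lift (fun a => y (some a)) ?_, ?_⟩
      · rintro a b ⟨h, -, hmem⟩
        have := (mem_edgeHyperplane _ _ _ _).1 (hy _ hmem)
        rw [h0, mul_zero] at this
        exact sub_eq_zero.1 this
      · funext o
        cases o
        · exact h0.symm
        · rfl
  rw [← hrange, LinearMap.finrank_range_of_inj hinj, Module.finrank_fintype_fun_eq_card,
    Nat.card_eq_fintype_card]

/-- Subtracting `p a * z` from each coordinate turns the equations into equality along components,
leaving `z` and one free parameter per component. -/
theorem finrank_sInf_of_potential {F : Set (Submodule K (Option Γ.V → K))}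
    (hF : F ⊆ Γ.extendedLiftArrangement.carrier) (hinf : hyperplaneAtInfinity K Γ.V ∉ F)
    (p : Γ.V → G)
    (hp : ∀ (a b : Γ.V) (h : G), Γ.Adj a b h → edgeHyperplane a b (h : K) ∈ F → p a - p b = h) :
    Module.finrank K (sInf F : Submodule K (Option Γ.V → K)) = Nat.card (Quot fun a b =>
      ∃ h : G, Γ.Adj a b h ∧ edgeHyperplane a b (h : K) ∈ F) + 1 := by
  set r : Γ.V → Γ.V → Prop := fun a b => ∃ h : G, Γ.Adj a b h ∧ edgeHyperplane a b (h : K) ∈ F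
  have := Fintype.ofFinite (Quot r)
  let φ : (K × (Quot r → K)) →ₗ[K] (Option Γ.V → K) :=
    { toFun c := consVector c.1 fun a => c.2 (Quot.mk r a) + p a * c.1
      map_add' c c' := by
        funext o
        cases o
        · simp
        · simp only [consVector_some, Prod.snd_add, Pi.add_apply, Prod.fst_add]
          ring
      map_smul' s c := by
        funext o
        cases o
        · simp
        · simp only [consVector_some, Prod.smul_snd, Pi.smul_apply, Prod.smul_fst, smul_eq_mul,
            RingHom.id_apply]
          ring }
  have hinj : Function.Injective φ := by
    intro c c' h
    have h0 : c.1 = c'.1 := congrFun h none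
    refine Prod.ext h0 (funext fun q => ?_)
    induction q using Quot.ind with
    | mk a =>
      have h1 : c.2 (Quot.mk r a) + p a * c.1 = c'.2 (Quot.mk r a) + p a * c'.1 :=
        congrFun h (some a)
      rw [h0] at h1
      exact add_right_cancel h1
  have hp' : ∀ (a b : Γ.V) (h : G), Γ.Adj a b h → edgeHyperplane a b (h : K) ∈ F →
      (p a : K) - p b = h := fun a b h hab hmem => by
    rw [← hp a b h hab hmem, AddSubgroup.coe_sub]
  have hrange : LinearMap.range φ = sInf F := by
    ext y
    rw [LinearMap.mem_range, Submodule.mem_sInf]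
    constructor
    · rintro ⟨c, rfl⟩ H hH
      rcases hF hH with rfl | ⟨a, b, h, hab, rfl⟩
      · exact absurd hH hinf
      · rw [mem_edgeHyperplane]
        have h1 : Quot.mk r a = Quot.mk r b := Quot.sound ⟨h, hab, hH⟩
        have h2 := hp' a b h hab hH
        change c.2 (Quot.mk r a) + p a * c.1 - (c.2 (Quot.mk r b) + p b * c.1) = h * c.1
        rw [h1]
        linear_combination c.1 * h2
    · intro hy
      refine ⟨(y none, Quot.lift (fun a => y (some a) - p a * y none) ?_), ?_⟩
      · rintro a b ⟨h, hab, hmem⟩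
        have h1 := (mem_edgeHyperplane _ _ _ _).1 (hy _ hmem)
        have h2 := hp' a b h hab hmem
        linear_combination h1 - y none * h2
      · funext o
        cases o
        · rfl
        · exact sub_add_cancel _ _
  rw [← hrange, LinearMap.finrank_range_of_inj hinj, Module.finrank_prod, Module.finrank_self,
    Module.finrank_fintype_fun_eq_card, Nat.card_eq_fintype_card, add_comm]

theorem card_setOf_pointSubmodule_le [Finite G] {F : Set (Submodule K (Option Γ.V → K))}
    (hF : F ⊆ Γ.extendedLiftArrangement.carrier) {k : ℕ} (z₀ : G × Fin k) :
    Nat.card {ω : (G × Fin k) × (Γ.V → G × Fin k) // ∀ H ∈ F, Γ.pointSubmodule z₀ ω ≤ H} =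
      (Nat.card G * k) ^ Module.finrank K (sInf F : Submodule K (Option Γ.V → K)) := by
  classical
  have hT : Nat.card (G × Fin k) = Nat.card G * k := by
    rw [Nat.card_prod, Nat.card_eq_fintype_card (α := Fin k), Fintype.card_fin]
  have hTpos : 0 < Nat.card (G × Fin k) := Nat.card_pos_iff.2 ⟨⟨z₀⟩, inferInstance⟩
  have h1 := Nat.card_subtype_prod_ite (X := Γ.V → G × Fin k) z₀
    (P := fun ω => ∀ H ∈ F, Γ.pointSubmodule z₀ ω ≤ H)
    (P₀ := fun x => ∀ H ∈ F, infinitePoint x ≤ H) (P₁ := fun x => ∀ H ∈ F, finitePoint x ≤ H)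
    (fun x => by simp [pointSubmodule]) (fun z x hz => by simp [pointSubmodule, hz])
  rw [h1]
  have h2 : Nat.card {x : Γ.V → G × Fin k // ∀ H ∈ F, infinitePoint x ≤ H} =
      (Nat.card G * k) ^ Nat.card (Quot fun a b =>
        ∃ h : G, Γ.Adj a b h ∧ edgeHyperplane a b (h : K) ∈ F) := by
    rw [Nat.card_congr (Equiv.subtypeEquivRight (Γ.infinitePoint_le_iff hF)),
      Nat.card_congr (quotFunEquiv _ _), Nat.card_fun, hT]
  rw [h2]
  by_cases hle : sInf F ≤ hyperplaneAtInfinity K Γ.V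
  · have : IsEmpty {x : Γ.V → G × Fin k // ∀ H ∈ F, finitePoint x ≤ H} := by
      refine ⟨fun x => not_finitePoint_le_hyperplaneAtInfinity x.1 ?_⟩
      exact (le_sInf x.2).trans hle
    rw [Γ.finrank_sInf_of_le hF hle, Nat.card_of_isEmpty (α := {x : Γ.V → G × Fin k // _}),
      mul_zero, add_zero]
  · have hinf : hyperplaneAtInfinity K Γ.V ∉ F := fun h => hle (sInf_le h)
    obtain ⟨y, hy, hy0⟩ := Set.not_subset.1 hle
    have hy0 : y none ≠ 0 := hy0
    -- A vector off the hyperplane at infinity, scaled to `z = 1`, is a potential with values in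
    -- `K`.
    obtain ⟨p, hp⟩ := exists_potential
      (fun a b (h : G) => Γ.Adj a b h ∧ edgeHyperplane a b (h : K) ∈ F)
      (fun a => y (some a) / y none) (by
        rintro a b h ⟨-, hmem⟩
        have := (mem_edgeHyperplane _ _ _ _).1 (Submodule.mem_sInf.1 hy _ hmem)
        rw [← sub_div, this, mul_div_cancel_right₀ _ hy0])
    let e : (Γ.V → G × Fin k) ≃ (Γ.V → G × Fin k) :=
      { toFun x a := GainRelation.shift (p a) (x a)
        invFun x a := GainRelation.shift (-p a) (x a)
        left_inv x := by
          funext a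
          simp [GainRelation.shift_shift]
        right_inv x := by
          funext a
          simp [GainRelation.shift_shift] }
    -- Shifting colours by the potential turns constancy along the edges of `F` into the conditions
    -- for finite points. With `c` components the total is `t ^ c + (t - 1) t ^ c = t ^ (c + 1)`.
    have h3 : Nat.card {x : Γ.V → G × Fin k // ∀ H ∈ F, finitePoint x ≤ H} =
        Nat.card {x : Γ.V → G × Fin k // ∀ H ∈ F, infinitePoint x ≤ H} := by
      refine (Nat.card_congr (e.subtypeEquiv fun x => ?_)).symm
      rw [Γ.infinitePoint_le_iff hF]
      have key : ∀ a b h, Γ.Adj a b h → edgeHyperplane a b (h : K) ∈ F →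
          (x a = x b ↔ e x a = GainRelation.shift h (e x b)) := by
        intro a b h hab hmem
        simp only [e, Equiv.coe_fn_mk]
        rw [GainRelation.shift_shift, ← hp a b h ⟨hab, hmem⟩, sub_add_cancel,
          (GainRelation.shift_right_injective (p a)).eq_iff]
      constructor
      · intro hx H hH
        rcases hF hH with rfl | ⟨a, b, h, hab, rfl⟩
        · exact absurd hH hinf
        · rw [finitePoint_le_edgeHyperplane_iff]
          exact (key a b h hab hH).1 (hx a b ⟨h, hab, hH⟩)
      · rintro hx a b ⟨h, hab, hmem⟩
        exact (key a b h hab hmem).2 ((finitePoint_le_edgeHyperplane_iff _ a b h).1 (hx _ hmem))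
    rw [h3, h2, Γ.finrank_sInf_of_potential hF hinf p fun a b h hab hmem => hp a b h ⟨hab, hmem⟩,
      pow_succ, ← hT]
    obtain ⟨t, ht⟩ := Nat.exists_eq_succ_of_ne_zero hTpos.ne'
    rw [ht, Nat.succ_sub_one, Nat.succ_eq_add_one]
    ring

/-- Characteristic polynomials of contractions of the extended lift matroid, by counting. -/
theorem eval_charPoly_contract [Finite G] {Y : Set (Submodule K (Option Γ.V → K))}
    (hY : Γ.extendedLiftArrangement.matroid.IsFlat Y) {k : ℕ} (z₀ : G × Fin k) :
    (Γ.extendedLiftArrangement.matroid.contract Y).charPoly.eval ((Nat.card G * k : ℕ) : ℤ) *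
        ((Nat.card G * k : ℕ) : ℤ) ^
          (Nat.card Γ.V + 1 - Γ.extendedLiftArrangement.matroid.eRank.toNat) =
      (Nat.card {ω : (G × Fin k) × (Γ.V → G × Fin k) //
        {H | H ∈ Γ.extendedLiftArrangement.carrier ∧ Γ.pointSubmodule z₀ ω ≤ H} = Y} : ℤ) := by
  have := Fintype.ofFinite Γ.V
  have hdim : Module.finrank K (Option Γ.V → K) = Nat.card Γ.V + 1 := by
    rw [Module.finrank_fintype_fun_eq_card, Fintype.card_option, Nat.card_eq_fintype_card]
  refine Matroid.eval_charPoly_contract _ hY _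
    (fun ω => Γ.extendedLiftArrangement.isFlat_setOf_le _) _ _ ?_ ?_
  · rw [← Matroid.eRk_ground, Arrangement.matroid_ground, Arrangement.eRk_eq_codim _ subset_rfl,
      ENat.toNat_natCast, ← hdim]
    exact Submodule.finrank_quotient_le _
  · intro F hF
    have hFE : F ⊆ Γ.extendedLiftArrangement.carrier := hF.subset_ground
    rw [Arrangement.eRk_eq_codim _ hFE, ENat.toNat_natCast, ← hdim,
      ← (sInf F : Submodule K (Option Γ.V → K)).finrank_quotient_add_finrank,
      Nat.add_sub_cancel_left, ← Γ.card_setOf_pointSubmodule_le hFE z₀]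
    exact Nat.card_congr (Equiv.subtypeEquivRight fun ω =>
      ⟨fun h H hH => (h hH).2, fun h H hH => ⟨hFE hH, h H hH⟩⟩)

end LooplessGainGraph

/-! ### Composition of contractions and their colourings -/

namespace GainRelation

variable {V : Type u} {G : Type v} [AddCommGroup G]

theorem contract_contract (A : GainRelation V G) (f f' : V → V) (p p' : V → G) :
    (A.contract f p).contract f' p' = A.contract (f' ∘ f) (fun a => p a + p' (f a)) := by
  funext a b h
  apply propext
  constructor
  · rintro ⟨hab, _, _, hc, hd, -, c, d, rfl, rfl, hA⟩
    refine ⟨hab, c, d, hc, hd, ?_⟩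
    dsimp only
    rwa [show h + (p c + p' (f c)) - (p d + p' (f d)) =
      h + p' (f c) - p' (f d) + p c - p d by abel]
  · rintro ⟨hab, c, d, hc, hd, hA⟩
    refine ⟨hab, f c, f d, hc, hd, fun h => hab ?_, c, d, rfl, rfl, ?_⟩
    · rw [← hc, ← hd, Function.comp_apply, h, Function.comp_apply]
    · dsimp only at hA
      rwa [show h + p' (f c) - p' (f d) + p c - p d =
        h + (p c + p' (f c)) - (p d + p' (f d)) by abel]

theorem contract_id {A : GainRelation V G} (hne : ∀ a b h, A a b h → a ≠ b) :
    A.contract id 0 = A := by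
  funext a b h
  apply propext
  constructor
  · rintro ⟨-, c, d, rfl, rfl, hA⟩
    simpa using hA
  · intro hA
    exact ⟨hne a b h hA, a, b, rfl, rfl, by simpa using hA⟩

/-- Colourings compatible with a contraction correspond to colourings of the contracted graph
in which the contracted vertices are isolated. -/
theorem card_compatible_mul (A : GainRelation V G) {f : V → V} {p : V → G} [Finite V]
    (hf : ∀ a, f (f a) = f a) (hp : ∀ a, p (f a) = 0) (k : ℕ) :
    Nat.card {x : V → G × Fin k // (∀ a, x a = shift (p a) (x (f a))) ∧
        (A.contract f p).IsProper x} * (Nat.card G * k) ^ Nat.card {a // f a ≠ a} =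
      (A.contract f p).numProper k := by
  classical
  have hT : Nat.card (G × Fin k) = Nat.card G * k := by
    rw [Nat.card_prod, Nat.card_eq_fintype_card (α := Fin k), Fintype.card_fin]
  -- Edges of the contraction end in values of the retraction `f`, so properness depends only on the
  -- colours of the fixed vertices.
  have hcongr : ∀ {x y : V → G × Fin k}, (∀ a, f a = a → x a = y a) →
      (A.contract f p).IsProper x → (A.contract f p).IsProper y := by
    rintro x y hxy hx a b h hab heq
    refine hx a b h hab ?_
    obtain ⟨-, c, d, rfl, rfl, -⟩ := hab
    rw [hxy _ (hf c), hxy _ (hf d), heq]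
  let e : {x : V → G × Fin k // (∀ a, x a = shift (p a) (x (f a))) ∧
      (A.contract f p).IsProper x} × ({a // f a ≠ a} → G × Fin k) ≃
      {x : V → G × Fin k // (A.contract f p).IsProper x} :=
    { toFun q := ⟨fun a => if h : f a = a then q.1.1 a else q.2 ⟨a, h⟩,
        hcongr (fun a ha => by simp [ha]) q.1.2.2⟩
      invFun x := (⟨fun a => shift (p a) (x.1 (f a)),
        ⟨fun a => by simp [hf, hp], hcongr (fun a ha => by
          have h0 := hp a
          rw [ha] at h0
          simp [ha, h0]) x.2⟩⟩, fun a => x.1 a)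
      left_inv q := by
        refine Prod.ext (Subtype.ext (funext fun a => ?_)) (funext fun a => ?_)
        · simp only [hf, dite_true]
          exact (q.1.2.1 a).symm
        · simp [a.2]
      right_inv x := by
        refine Subtype.ext (funext fun a => ?_)
        by_cases ha : f a = a
        · have h0 := hp a
          rw [ha] at h0
          simp [ha, h0]
        · simp [ha] }
  unfold numProper
  rw [← Nat.card_congr e, Nat.card_prod, Nat.card_fun, hT]

end GainRelation

/-! ### Flats defined by contractions, and their characteristic polynomials -/

namespace LooplessGainGraph

variable {K : Type v} [Field K] {G : AddSubgroup K}

/-- The subspace defined by the identifications of a contraction. -/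
def contractionSubmodule {V : Type u} (f : V → V) (p : V → G) : Submodule K (Option V → K) :=
  gainSubmodule fun a b h => b = f a ∧ h = p a

theorem mem_contractionSubmodule {V : Type u} {f : V → V} {p : V → G} {y : Option V → K} :
    y ∈ contractionSubmodule f p ↔ ∀ a, y (some a) - y (some (f a)) = p a * y none :=
  ⟨fun h a => h a (f a) (p a) ⟨rfl, rfl⟩, by
    rintro h a b _ ⟨rfl, rfl⟩
    exact h a⟩

theorem not_contractionSubmodule_le_hyperplaneAtInfinity {V : Type u} {f : V → V} {p : V → G}
    (hp : ∀ a, p (f a) = 0) : ¬ contractionSubmodule f p ≤ hyperplaneAtInfinity K V := by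
  intro h
  have h1 : consVector 1 (fun a => (p a : K)) ∈ contractionSubmodule f p := by
    rw [mem_contractionSubmodule]
    intro a
    simp [hp]
  have h2 := h h1
  rw [mem_hyperplaneAtInfinity] at h2
  simp at h2

theorem contractionSubmodule_le_edgeHyperplane_iff {V : Type u} {f : V → V} {p : V → G}
    (hf : ∀ a, f (f a) = f a) (hp : ∀ a, p (f a) = 0) (a b : V) (h : G) :
    contractionSubmodule f p ≤ edgeHyperplane a b (h : K) ↔ f a = f b ∧ p a = h + p b := by
  classical
  constructor
  · intro hle
    have h1 : consVector 1 (fun a => (p a : K)) ∈ contractionSubmodule f p := by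
      rw [mem_contractionSubmodule]
      intro a
      simp [hp]
    have h2 := (mem_edgeHyperplane _ _ _ _).1 (hle h1)
    simp only [consVector_some, consVector_none, mul_one] at h2
    refine ⟨?_, Subtype.ext ?_⟩
    · by_contra hne
      have h3 : consVector 0 (fun c => if f c = f a then (1 : K) else 0) ∈
          contractionSubmodule f p := by
        rw [mem_contractionSubmodule]
        intro c
        simp [hf]
      have h4 := (mem_edgeHyperplane _ _ _ _).1 (hle h3)
      simp [Ne.symm hne] at h4
    · rw [AddSubgroup.coe_add]
      linear_combination h2
  · rintro ⟨hab, hpab⟩ y hy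
    rw [mem_contractionSubmodule] at hy
    rw [mem_edgeHyperplane]
    have h1 := hy a
    have h2 := hy b
    rw [hab, hpab, AddSubgroup.coe_add] at h1
    linear_combination h1 - h2

variable (Γ : LooplessGainGraph.{u} G)

/-- The flat of the hyperplanes that contain the subspace of a contraction. -/
def contractionFlat (f : Γ.V → Γ.V) (p : Γ.V → G) : Set (Submodule K (Option Γ.V → K)) :=
  {H | H ∈ Γ.extendedLiftArrangement.carrier ∧ contractionSubmodule f p ≤ H}

/-- Contractions of `i` edges, with `f` a retraction onto representatives of the blocks and `p`
the gains that lead to the representatives. -/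
structure IsContraction (i : ℕ) (f : Γ.V → Γ.V) (p : Γ.V → G) : Prop where
  idem : ∀ a, f (f a) = f a
  gain_eq_zero : ∀ a, p (f a) = 0
  codim : Module.finrank K ((Option Γ.V → K) ⧸ contractionSubmodule (K := K) f p) = i
  card_ne : Nat.card {a // f a ≠ a} = i
  sInf_eq : sInf (Γ.contractionFlat f p) = contractionSubmodule f p

variable {Γ}

/-- The flat omits the hyperplane at infinity, so the point must be finite. Lying on all hyperplanes
of the flat forces compatibility with `f` and `p`, by `sInf_eq`; lying on no others is properness
for the contracted graph. -/
theorem IsContraction.setOf_pointSubmodule_le_eq_iff {i : ℕ} {f : Γ.V → Γ.V} {p : Γ.V → G}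
    (h : Γ.IsContraction i f p) {k : ℕ} {z₀ : G × Fin k} (z : G × Fin k) (x : Γ.V → G × Fin k) :
    {H | H ∈ Γ.extendedLiftArrangement.carrier ∧ Γ.pointSubmodule z₀ (z, x) ≤ H} =
        Γ.contractionFlat f p ↔
      z ≠ z₀ ∧ (∀ a, x a = GainRelation.shift (p a) (x (f a))) ∧
        (GainRelation.contract Γ.Adj f p).IsProper x := by
  have hinf : hyperplaneAtInfinity K Γ.V ∉ Γ.contractionFlat f p := fun hmem =>
    not_contractionSubmodule_le_hyperplaneAtInfinity h.gain_eq_zero hmem.2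
  have hedge := contractionSubmodule_le_edgeHyperplane_iff (K := K) h.idem h.gain_eq_zero
  by_cases hz : z = z₀
  · subst hz
    simp only [pointSubmodule, if_true, ne_eq, not_true_eq_false, false_and, iff_false]
    intro heq
    exact hinf (heq ▸ ⟨Γ.hyperplaneAtInfinity_mem, inf_le_left⟩)
  · simp only [pointSubmodule, hz, if_false, ne_eq, not_false_eq_true, true_and]
    constructor
    · intro heq
      have hx : ∀ a, x a = GainRelation.shift (p a) (x (f a)) := by
        intro a
        rw [← finitePoint_le_edgeHyperplane_iff]
        have h1 : finitePoint x ≤ contractionSubmodule f p := by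
          rw [← h.sInf_eq, ← heq]
          exact le_sInf fun H hH => hH.2
        refine h1.trans ((hedge _ _ _).2 ⟨(h.idem a).symm, ?_⟩)
        rw [h.gain_eq_zero, add_zero]
      refine ⟨hx, ?_⟩
      rintro _ _ g ⟨hne, c, d, rfl, rfl, hA⟩ hxg
      have h1 : edgeHyperplane c d ((g + p c - p d : G) : K) ∈ Γ.contractionFlat f p := by
        rw [← heq]
        refine ⟨edgeHyperplane_mem hA, (finitePoint_le_edgeHyperplane_iff _ _ _ _).2 ?_⟩
        rw [hx c, hx d, hxg, GainRelation.shift_shift, GainRelation.shift_shift]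
        congr 1
        abel
      exact hne ((hedge _ _ _).1 h1.2).1
    · rintro ⟨hx, hpr⟩
      ext H
      refine and_congr_right fun hH => ?_
      rcases hH with rfl | ⟨c, d, g, hA, rfl⟩
      · exact iff_of_false (not_finitePoint_le_hyperplaneAtInfinity x)
          (not_contractionSubmodule_le_hyperplaneAtInfinity h.gain_eq_zero)
      · rw [finitePoint_le_edgeHyperplane_iff, hedge, hx c, hx d, GainRelation.shift_shift]
        by_cases hcd : f c = f d
        · rw [hcd, GainRelation.shift_left_inj]
          simp
        · refine iff_of_false (fun heq => ?_) fun h => hcd h.1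
          refine hpr (f c) (f d) (g + p d - p c) ⟨hcd, c, d, rfl, rfl, by simpa using hA⟩ ?_
          rw [eq_comm, GainRelation.shift_eq_iff, GainRelation.shift_shift, eq_comm] at heq
          rw [heq]
          congr 1
          abel

theorem IsContraction.isFlat {i : ℕ} {f : Γ.V → Γ.V} {p : Γ.V → G} (_ : Γ.IsContraction i f p) :
    Γ.extendedLiftArrangement.matroid.IsFlat (Γ.contractionFlat f p) :=
  Γ.extendedLiftArrangement.isFlat_setOf_le _

theorem IsContraction.eRk_eq {i : ℕ} {f : Γ.V → Γ.V} {p : Γ.V → G} (h : Γ.IsContraction i f p) :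
    Γ.extendedLiftArrangement.matroid.eRk (Γ.contractionFlat f p) = i := by
  rw [Arrangement.eRk_eq_codim _ fun H hH => hH.1, h.sInf_eq, h.codim]

/-- The factor `t - 1` counts the scalars other than `z₀`, and `t ^ i` the free colours of the `i`
vertices that have become isolated. -/
theorem IsContraction.eval_charPoly [Finite G] {i : ℕ} {f : Γ.V → Γ.V} {p : Γ.V → G}
    (h : Γ.IsContraction i f p) {k : ℕ} (z₀ : G × Fin k) :
    (Γ.extendedLiftArrangement.matroid.contract (Γ.contractionFlat f p)).charPoly.eval
        ((Nat.card G * k : ℕ) : ℤ) * ((Nat.card G * k : ℕ) : ℤ) ^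
          (Nat.card Γ.V + 1 - Γ.extendedLiftArrangement.matroid.eRank.toNat) *
        ((Nat.card G * k : ℕ) : ℤ) ^ i =
      ((Nat.card G * k - 1 : ℕ) : ℤ) * (GainRelation.contract Γ.Adj f p).numProper k := by
  have hT : Nat.card (G × Fin k) = Nat.card G * k := by
    rw [Nat.card_prod, Nat.card_eq_fintype_card (α := Fin k), Fintype.card_fin]
  rw [Γ.eval_charPoly_contract h.isFlat z₀, ← GainRelation.card_compatible_mul Γ.Adj h.idem
    h.gain_eq_zero k, h.card_ne, Nat.card_subtype_prod_ite z₀ (P₀ := fun _ => False)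
    (P₁ := fun x => (∀ a, x a = GainRelation.shift (p a) (x (f a))) ∧
        (GainRelation.contract Γ.Adj f p).IsProper x)
    (fun x => by simp [h.setOf_pointSubmodule_le_eq_iff])
    (fun z x hz => by simp [h.setOf_pointSubmodule_le_eq_iff, hz]), hT]
  have : IsEmpty {x : Γ.V → G × Fin k // False} := ⟨fun x => x.2⟩
  rw [Nat.card_of_isEmpty (α := {x : Γ.V → G × Fin k // False})]
  push_cast
  ring

theorem IsContraction.dvd_of_countDvd [Finite G] {i : ℕ} {f f' : Γ.V → Γ.V} {p p' : Γ.V → G}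
    (h : Γ.IsContraction i f p) (h' : Γ.IsContraction (i + 1) f' p')
    (hdvd : (GainRelation.contract Γ.Adj f p).CountDvd (GainRelation.contract Γ.Adj f' p')) :
    (Γ.extendedLiftArrangement.matroid.contract (Γ.contractionFlat f' p')).charPoly ∣
      (Γ.extendedLiftArrangement.matroid.contract (Γ.contractionFlat f p)).charPoly := by
  obtain ⟨q, hq⟩ := hdvd
  refine ⟨q, ?_⟩
  -- The identity is checked at infinitely many `t`; adding `|V| + 1` meets the bound in `CountDvd`
  -- and makes `t` nonzero. The surplus factor `t` in `CountDvd` matches the one more isolated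
  -- vertex.
  refine Polynomial.eq_of_infinite_eval_eq _ _ (Set.infinite_of_injective_forall_mem
    (f := fun k : ℕ => ((Nat.card G * (k + (Nat.card Γ.V + 1)) : ℕ) : ℤ)) ?_ ?_)
  · intro k l hkl
    have h1 : Nat.card G * (k + (Nat.card Γ.V + 1)) = Nat.card G * (l + (Nat.card Γ.V + 1)) :=
      Nat.cast_injective hkl
    exact Nat.add_right_cancel (Nat.eq_of_mul_eq_mul_left Nat.card_pos h1)
  · intro k
    set n := k + (Nat.card Γ.V + 1) with hn
    let z₀ : G × Fin n := (0, ⟨0, by omega⟩)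
    have e1 := h.eval_charPoly z₀
    have e2 := h'.eval_charPoly z₀
    have e3 := hq n (by omega)
    have ht : ((Nat.card G * n : ℕ) : ℤ) ≠ 0 := by
      have : 0 < Nat.card G * n := Nat.mul_pos Nat.card_pos (by omega)
      exact_mod_cast this.ne'
    set t : ℤ := ((Nat.card G * n : ℕ) : ℤ)
    rw [Set.mem_ofPred_eq, eval_mul]
    apply mul_right_cancel₀ (pow_ne_zero (Nat.card Γ.V + 1 -
      Γ.extendedLiftArrangement.matroid.eRank.toNat) ht)
    apply mul_right_cancel₀ (pow_ne_zero (i + 1) ht)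
    linear_combination t * e1 - q.eval t * e2 + ((Nat.card G * n - 1 : ℕ) : ℤ) * e3

/-- The contraction of no edges. -/
theorem isContraction_id (Γ : LooplessGainGraph.{u} G) : Γ.IsContraction 0 id 0 := by
  have htop : contractionSubmodule (K := K) (id : Γ.V → Γ.V) (0 : Γ.V → G) = ⊤ := by
    refine eq_top_iff.2 fun y _ => mem_contractionSubmodule.2 fun a => ?_
    simp
  refine ⟨fun a => rfl, fun a => rfl, ?_, by simp, ?_⟩
  · rw [htop]
    have := (⊤ : Submodule K (Option Γ.V → K)).finrank_quotient_add_finrank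
    rw [finrank_top] at this
    omega
  · rw [htop, eq_top_iff]
    refine le_sInf fun H hH => ?_
    rw [← htop]
    exact hH.2

theorem contractionFlat_id (Γ : LooplessGainGraph.{u} G) : Γ.contractionFlat id 0 = ∅ := by
  refine Set.eq_empty_iff_forall_notMem.2 fun H hH => ?_
  rcases hH with ⟨rfl | ⟨a, b, h, hab, rfl⟩, hle⟩
  · exact not_contractionSubmodule_le_hyperplaneAtInfinity Γ.isContraction_id.gain_eq_zero hle
  · exact Γ.ne_of_adj hab ((contractionSubmodule_le_edgeHyperplane_iff
      Γ.isContraction_id.idem Γ.isContraction_id.gain_eq_zero a b h).1 hle).1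

open Classical in
/-- The contraction of one more edge. -/
theorem IsContraction.elim {i : ℕ} {f : Γ.V → Γ.V} {p : Γ.V → G} (h : Γ.IsContraction i f p)
    {u v : Γ.V} {g : G} (huv : GainRelation.contract Γ.Adj f p u v g) :
    Γ.IsContraction (i + 1) (GainRelation.mergeMap u v ∘ f)
        (fun a => p a + (Pi.single v (-g) : Γ.V → G) (f a)) ∧
      Γ.contractionFlat f p ⊆ Γ.contractionFlat (GainRelation.mergeMap u v ∘ f)
        (fun a => p a + (Pi.single v (-g) : Γ.V → G) (f a)) := by
  obtain ⟨hne, c, d, rfl, rfl, hA⟩ := huv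
  have hm : ∀ a, GainRelation.mergeMap (f c) (f d) a ≠ f d := by
    intro a
    unfold GainRelation.mergeMap
    split_ifs with h
    exacts [hne, h]
  have hmm : ∀ a, a ≠ f d → GainRelation.mergeMap (f c) (f d) a = a := fun a ha => by
    simp [GainRelation.mergeMap, ha]
  have hmd : GainRelation.mergeMap (f c) (f d) (f d) = f c := by simp [GainRelation.mergeMap]
  have hfm : ∀ a, f (GainRelation.mergeMap (f c) (f d) (f a)) =
      GainRelation.mergeMap (f c) (f d) (f a) := by
    intro a
    unfold GainRelation.mergeMap
    split_ifs
    exacts [h.idem c, h.idem a]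
  set f' := GainRelation.mergeMap (f c) (f d) ∘ f with hf'
  set p' : Γ.V → G := fun a => p a + (Pi.single (f d) (-g) : Γ.V → G) (f a) with hp'
  have hidem : ∀ a, f' (f' a) = f' a := by
    intro a
    simp only [hf', Function.comp_apply, hfm]
    exact hmm _ (hm _)
  have hgain : ∀ a, p' (f' a) = 0 := by
    intro a
    simp only [hp', hf', Function.comp_apply, hfm, Pi.single_eq_of_ne (hm (f a)), add_zero]
    rw [← hfm a, h.gain_eq_zero]
  have hsub : Γ.contractionFlat f p ⊆ Γ.contractionFlat f' p' := by
    rintro H ⟨hH, hle⟩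
    refine ⟨hH, ?_⟩
    rcases hH with rfl | ⟨a, b, s, hab, rfl⟩
    · exact absurd hle (not_contractionSubmodule_le_hyperplaneAtInfinity h.gain_eq_zero)
    · rw [contractionSubmodule_le_edgeHyperplane_iff h.idem h.gain_eq_zero] at hle
      rw [contractionSubmodule_le_edgeHyperplane_iff hidem hgain]
      refine ⟨by simp only [hf', Function.comp_apply, hle.1], ?_⟩
      simp only [hp', hle.1, hle.2]
      abel
  -- This is the gain of the original edge between `c` and `d` that becomes the contracted one. Its
  -- hyperplane does not contain the old subspace and cuts it in the new one, so the codimension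
  -- grows by exactly one.
  set s : G := g + p c - p d with hs
  have hle' : contractionSubmodule f' p' ≤ edgeHyperplane c d (s : K) := by
    rw [contractionSubmodule_le_edgeHyperplane_iff hidem hgain]
    refine ⟨?_, ?_⟩
    · simp only [hf', Function.comp_apply, hmd]
      exact hmm _ hne
    · simp only [hp', hs, Pi.single_eq_same, Pi.single_eq_of_ne hne]
      abel
  have hnle : ¬ contractionSubmodule f p ≤ edgeHyperplane c d (s : K) := by
    rw [contractionSubmodule_le_edgeHyperplane_iff h.idem h.gain_eq_zero]
    exact fun h => hne h.1
  have hmem : edgeHyperplane c d (s : K) ∈ Γ.extendedLiftArrangement.carrier :=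
    edgeHyperplane_mem hA
  have hinf : contractionSubmodule f' p' = edgeHyperplane c d (s : K) ⊓
      contractionSubmodule f p := by
    refine le_antisymm (le_inf hle' ?_) ?_
    · rw [← h.sInf_eq]
      exact le_sInf fun H hH => (hsub hH).2
    · rintro y ⟨hy₁, hy₂⟩
      rw [SetLike.mem_coe, mem_edgeHyperplane] at hy₁
      rw [SetLike.mem_coe, mem_contractionSubmodule] at hy₂
      rw [mem_contractionSubmodule]
      intro a
      have ha := hy₂ a
      by_cases had : f a = f d
      · have hc := hy₂ c
        have hd := hy₂ d
        simp only [hf', hp', Function.comp_apply, had, hmd, Pi.single_eq_same]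
        rw [had] at ha
        simp only [hs, AddSubgroup.coe_sub, AddSubgroup.coe_add] at hy₁
        push_cast
        linear_combination ha - hy₁ + hc - hd
      · simp only [hf', hp', Function.comp_apply, hmm _ had, Pi.single_eq_of_ne had, add_zero]
        exact ha
  refine ⟨⟨hidem, hgain, ?_, ?_, ?_⟩, hsub⟩
  · have h1 := codim_inf_le (P := contractionSubmodule f p)
      (Γ.extendedLiftArrangement.codim_eq_one _ hmem)
    have h2 := codim_inf_lt hnle
    rw [← hinf, h.codim] at h1 h2
    omega
  · have hset : {a | f' a ≠ a} = insert (f d) {a | f a ≠ a} := by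
      ext a
      simp only [Set.mem_ofPred_eq, Set.mem_insert_iff]
      constructor
      · intro ha
        by_contra hcon
        push Not at hcon
        apply ha
        simp only [hf', Function.comp_apply, hcon.2]
        exact hmm _ hcon.1
      · rintro (rfl | ha)
        · exact hm _
        · intro heq
          apply ha
          rw [← heq]
          exact hfm a
    have h1 : Set.ncard {a | f' a ≠ a} = i + 1 := by
      rw [hset, Set.ncard_insert_of_notMem (by simp [h.idem]), ← h.card_ne]
      rfl
    exact h1
  · refine le_antisymm ?_ (le_sInf fun H hH => hH.2)
    rw [hinf]
    refine le_inf (sInf_le ⟨hmem, hle'⟩) ?_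
    rw [← h.sInf_eq]
    exact sInf_le_sInf hsub

/-- Reductions of the gain graph give chains of contractions. -/
theorem IsContraction.exists_chain {B : GainRelation Γ.V G}
    (hB : GainRelation.ContractsOnto ∅ B) : ∀ {i : ℕ} {f : Γ.V → Γ.V} {p : Γ.V → G},
      Γ.IsContraction i f p → B = GainRelation.contract Γ.Adj f p →
      ∃ (m : ℕ) (s : ℕ → (Γ.V → Γ.V) × (Γ.V → G)), s 0 = (f, p) ∧
        (∀ j ≤ m, Γ.IsContraction (i + j) (s j).1 (s j).2) ∧
        (∀ j < m, Γ.contractionFlat (s j).1 (s j).2 ⊆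
            Γ.contractionFlat (s (j + 1)).1 (s (j + 1)).2 ∧
          (GainRelation.contract Γ.Adj (s j).1 (s j).2).CountDvd
            (GainRelation.contract Γ.Adj (s (j + 1)).1 (s (j + 1)).2)) ∧
        GainRelation.contract Γ.Adj (s m).1 (s m).2 = GainRelation.complete ∅ := by
  classical
  induction hB with
  | of_complete B hB =>
    intro i f p h hBf
    refine ⟨0, fun _ => (f, p), rfl, fun j hj => ?_, fun j hj => absurd hj (Nat.not_lt_zero j),
      hBf.symm.trans hB⟩
    obtain rfl := Nat.le_zero.1 hj
    exact h
  | elim B u v g hv huv hA hdvd hB ih =>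
    intro i f p h hBf
    subst hBf
    obtain ⟨h1, h2⟩ := h.elim hA
    have hBe : (GainRelation.contract Γ.Adj f p).elim u v g = _ :=
      GainRelation.contract_contract Γ.Adj f _ p _
    obtain ⟨m, s, hs0, hs1, hs2, hs3⟩ := ih h1 hBe
    refine ⟨m + 1, fun j => Nat.casesOn j (f, p) s, rfl, ?_, ?_, hs3⟩
    · rintro (_ | j) hj
      · exact h
      · have := hs1 j (by omega)
        rwa [show i + 1 + j = i + (j + 1) by ring] at this
    · rintro (_ | j) hj
      · dsimp only
        rw [hs0]
        refine ⟨h2, ?_⟩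
        rwa [← hBe]
      · exact hs2 j (by omega)

/-- When no edge is left, only the hyperplane at infinity remains to be intersected. -/
theorem IsContraction.sInf_carrier {i : ℕ} {f : Γ.V → Γ.V} {p : Γ.V → G}
    (h : Γ.IsContraction i f p)
    (hlast : GainRelation.contract Γ.Adj f p = GainRelation.complete ∅) :
    sInf Γ.extendedLiftArrangement.carrier =
      hyperplaneAtInfinity K Γ.V ⊓ contractionSubmodule f p := by
  have hf : ∀ a b g, Γ.Adj a b g → f a = f b := by
    intro a b g hab
    by_contra hne
    have h1 : GainRelation.contract Γ.Adj f p (f a) (f b) (g + p b - p a) :=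
      ⟨hne, a, b, rfl, rfl, by simpa using hab⟩
    rw [hlast] at h1
    exact h1.1
  refine le_antisymm (le_inf (sInf_le Γ.hyperplaneAtInfinity_mem) ?_) (le_sInf fun H hH => ?_)
  · rw [← h.sInf_eq]
    exact sInf_le_sInf fun H hH => hH.1
  · rintro y ⟨hy₁, hy₂⟩
    rw [SetLike.mem_coe, mem_hyperplaneAtInfinity] at hy₁
    rw [SetLike.mem_coe, mem_contractionSubmodule] at hy₂
    rcases hH with rfl | ⟨a, b, g, hab, rfl⟩
    · exact (mem_hyperplaneAtInfinity _).2 hy₁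
    · rw [mem_edgeHyperplane]
      have ha := hy₂ a
      have hb := hy₂ b
      rw [hf a b g hab, hy₁] at ha
      rw [hy₁] at hb ⊢
      linear_combination ha - hb

/-- The points on all hyperplanes number `t` to the dimension of the common intersection, which is
exactly the power of `t` in the counting formula. -/
theorem charPoly_contract_ground [Finite G] (Γ : LooplessGainGraph.{u} G) :
    (Γ.extendedLiftArrangement.matroid.contract Γ.extendedLiftArrangement.carrier).charPoly = 1 := by
  have := Fintype.ofFinite Γ.V
  refine Polynomial.eq_of_infinite_eval_eq _ _ (Set.infinite_of_injective_forall_mem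
    (f := fun k : ℕ => ((Nat.card G * (k + 1) : ℕ) : ℤ)) ?_ ?_)
  · intro k l hkl
    have h1 : Nat.card G * (k + 1) = Nat.card G * (l + 1) := Nat.cast_injective hkl
    exact Nat.add_right_cancel (Nat.eq_of_mul_eq_mul_left Nat.card_pos h1)
  · intro k
    let z₀ : G × Fin (k + 1) := (0, 0)
    have e1 := Γ.eval_charPoly_contract (Matroid.ground_isFlat _) z₀
    have e2 := Γ.card_setOf_pointSubmodule_le subset_rfl z₀
    rw [Arrangement.matroid_ground, Nat.card_congr (Equiv.subtypeEquivRight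
      (q := fun ω => ∀ H ∈ Γ.extendedLiftArrangement.carrier, Γ.pointSubmodule z₀ ω ≤ H)
      fun ω => by
        rw [Set.ext_iff]
        exact ⟨fun h H hH => ((h H).2 hH).2, fun h H => ⟨fun hH => hH.1, fun hH => ⟨hH, h H hH⟩⟩⟩),
      e2, ← Matroid.eRk_ground, Arrangement.matroid_ground,
      Arrangement.eRk_eq_codim _ subset_rfl, ENat.toNat_natCast] at e1
    have hdim := (sInf Γ.extendedLiftArrangement.carrier :
      Submodule K (Option Γ.V → K)).finrank_quotient_add_finrank
    rw [Module.finrank_fintype_fun_eq_card, Fintype.card_option, ← Nat.card_eq_fintype_card] at hdim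
    rw [← hdim, Nat.add_sub_cancel_left] at e1
    have ht : ((Nat.card G * (k + 1) : ℕ) : ℤ) ≠ 0 := by
      have : 0 < Nat.card G * (k + 1) := Nat.mul_pos Nat.card_pos (by omega)
      exact_mod_cast this.ne'
    rw [Set.mem_ofPred_eq, eval_one]
    apply mul_right_cancel₀ (pow_ne_zero _ ht)
    rw [e1, one_mul, Nat.cast_pow]

end LooplessGainGraph

/-! ### Assembly of the divisional flag -/

theorem mainTheorem4 {K : Type v} [Field K] (G : AddSubgroup K) [Finite G]
    (Γ : LooplessGainGraph.{u} G) (hΓ : LooplessGainGraph.ExtendedLiftClass G Γ) :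
    Γ.extendedLiftArrangement.DivisionallyFree := by
  have hmap : GainRelation.map Γ.Adj id = Γ.Adj := by
    funext a b h
    exact propext ⟨by rintro ⟨c, d, rfl, rfl, h⟩; exact h, fun h => ⟨a, b, rfl, rfl, h⟩⟩
  have hB := GainRelation.contractsOnto_of_extendedLiftClass hΓ id Function.injective_id ∅
    fun a b h hab => hab.1.elim
  rw [hmap] at hB
  obtain ⟨m, s, hs0, hs1, hs2, hs3⟩ := LooplessGainGraph.IsContraction.exists_chain hB
    Γ.isContraction_id (GainRelation.contract_id fun a b h => Γ.ne_of_adj).symm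
  simp only [zero_add] at hs1
  set M := Γ.extendedLiftArrangement.matroid with hM
  -- After `m` contractions no edge is left, and the hyperplane at infinity raises the codimension
  -- once more.
  have hrank : M.eRk M.E = (m + 1 : ℕ) := by
    have hm := hs1 m le_rfl
    rw [hM, Arrangement.matroid_ground, Arrangement.eRk_eq_codim _ subset_rfl, hm.sInf_carrier hs3]
    have h1 := codim_inf_le (P := LooplessGainGraph.contractionSubmodule (s m).1 (s m).2)
      (Γ.extendedLiftArrangement.codim_eq_one _ Γ.hyperplaneAtInfinity_mem)
    have h2 := codim_inf_lt (LooplessGainGraph.not_contractionSubmodule_le_hyperplaneAtInfinity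
      (K := K) hm.gain_eq_zero)
    rw [hm.codim] at h1 h2
    congr 1
    omega
  -- Only the indices up to `m + 1` matter; the default value `M.E` supplies the last flat of the
  -- flag.
  let Y : ℕ → Set (Submodule K (Option Γ.V → K)) := fun j =>
    if j ≤ m then Γ.contractionFlat (s j).1 (s j).2 else M.E
  have hY : ∀ j ≤ m, Y j = Γ.contractionFlat (s j).1 (s j).2 := fun j hj => if_pos hj
  have hYlast : Y (m + 1) = M.E := if_neg (by omega)
  have hcases : ∀ i : Fin (m + 2), (i : ℕ) ≤ m ∨ (i : ℕ) = m + 1 := fun i => by omega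
  have hstep : ∀ j ≤ m, Y j ⊆ Y (j + 1) := by
    intro j hj
    rcases hj.lt_or_eq with hj' | rfl
    · rw [hY j hj, hY (j + 1) hj']
      exact (hs2 j hj').1
    · rw [hY j hj, hYlast]
      exact fun H hH => hH.1
  have hdvd : ∀ j ≤ m, (M.contract (Y (j + 1))).charPoly ∣ (M.contract (Y j)).charPoly := by
    intro j hj
    rcases hj.lt_or_eq with hj' | rfl
    · rw [hY j hj, hY (j + 1) hj']
      exact (hs1 j hj).dvd_of_countDvd (hs1 (j + 1) hj') (hs2 j hj').2
    · rw [hYlast]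
      exact Γ.charPoly_contract_ground ▸ one_dvd _
  refine ⟨m + 1, fun i => Y i, ?_, fun i => ?_, ?_, ?_, ?_, fun i => ?_, fun i => ?_⟩
  · rw [← Matroid.eRk_ground]
    exact hrank
  · rcases hcases i with hi | hi
    · rw [hY _ hi]
      exact (hs1 _ hi).isFlat
    · rw [hi, hYlast]
      exact M.ground_isFlat
  · refine Fin.monotone_iff_le_succ.2 fun i => ?_
    simp only [Fin.val_castSucc, Fin.val_succ]
    exact hstep i (by omega)
  · rw [Fin.val_zero, hY 0 (Nat.zero_le m), hs0]
    exact Γ.contractionFlat_id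
  · rw [Fin.val_last]
    exact hYlast
  · rcases hcases i with hi | hi
    · rw [hY _ hi]
      exact (hs1 _ hi).eRk_eq
    · rw [hi, hYlast]
      exact hrank
  · exact hdvd i (by omega)
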